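/- Let $k$ be a field of characteristic different from $2$ and let $H$ be a quasi-Hopf algebra over $k$ (in the sense of Drinfeld) with bijective antipode, comultiplication $\Delta(h)=h_1\otimes h_2$, counit $\varepsilon$ and reassociator $\Phi=X^1\otimes X^2\otimes X^3$, normalized by $({\rm id}\otimes\varepsilon\otimes{\rm id})(\Phi)=1\otimes 1$ and satisfying $({\rm id}\otimes\Delta)(\Delta(h))=\Phi\,(\Delta\otimes{\rm id})(\Delta(h))\,\Phi^{-1}$; write $\Phi^{-1}=x^1\otimes x^2\otimes x^3=y^1\otimes y^2\otimes y^3$ (summations understood). Let ${}^H_H\mathcal{YD}$ be the braided category of left Yetter–Drinfeld modules over $H$, with braiding $m\otimes n\mapsto m_{[-1]}\cdot n\otimes m_{[0]}$, where $m\mapsto m_{[-1]}\otimes m_{[0]}$ is the left coaction. Call a pair $(\sigma,v)$, consisting of an algebra map $\sigma:H\to k$ and an element $v\in H$, admissible if $$\sigma(v)=-1,\qquad \varepsilon(v)=1,\qquad \Delta(v)=\sigma(x^3X^2y^1)\,x^1X^1vy^2\otimes x^2vX^3y^3,$$ $$\sigma(h_2)\,h_1v=\sigma(h_1)\,vh_2\quad\text{for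 all } h\in H.$$ For an admissible pair let $B_{\sigma,v}$ be the vector space with basis $\{1,n\}$ with action $h\cdot 1=\varepsilon(h)1$, $h\cdot n=\sigma(h)n$; coaction $1\mapsto 1\otimes 1$, $n\mapsto v\otimes n$; multiplication with unit $1$ and $n^2=0$; comultiplication $\underline\Delta(1)=1\otimes 1$, $\underline\Delta(n)=n\otimes 1+1\otimes n$; counit $\underline\varepsilon(1)=1$, $\underline\varepsilon(n)=0$; antipode $\underline S(1)=1$, $\underline S(n)=-n$. Let $k[C_2]$ be the group Hopf algebra of the cyclic group of order $2$, with the trivial action $h\cdot b=\varepsilon(h)b$ and the trivial coaction $b\mapsto 1\otimes b$. Then: (1) for every admissible pair $(\sigma,v)$, $B_{\sigma,v}$ is a Hopf algebra in ${}^H_H\mathcal{YD}$, and so is $k[C_2]$ with the trivial action and coaction; (2) every Hopf algebra $B$ in ${}^H_H\mathcal{YD}$ with $\dim_k B=2$ is isomorphic, as a Hopf algebra in ${}^H_H\mathcal{YD}$, to $B_{\sigma,v}$ for some admissible pair $(\sigma,v)$ or to $k[C_2]$ with the trivial action and coaction. -/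

import Mathlib

open scoped TensorProduct

noncomputable section

/-! ### Quasi-bialgebras and quasi-Hopf algebras -/

section Contractions

variable {k H : Type*} [Field k] [Ring H] [Algebra k H]

/-- `a ⊗ b ↦ f(a) b`. -/
def contrFst (f : H →ₐ[k] k) : H ⊗[k] H →ₐ[k] H :=
  (Algebra.TensorProduct.lid k H).toAlgHom.comp
    (Algebra.TensorProduct.map f (AlgHom.id k H))

/-- `a ⊗ b ↦ f(b) a`. -/
def contrSnd (f : H →ₐ[k] k) : H ⊗[k] H →ₐ[k] H :=
  (Algebra.TensorProduct.rid k k H).toAlgHom.comp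
    (Algebra.TensorProduct.map (AlgHom.id k H) f)

/-- `a ⊗ b ⊗ c ↦ f(a) b ⊗ c`. -/
def contr₁ (f : H →ₐ[k] k) : H ⊗[k] (H ⊗[k] H) →ₐ[k] H ⊗[k] H :=
  (Algebra.TensorProduct.lid k (H ⊗[k] H)).toAlgHom.comp
    (Algebra.TensorProduct.map f (AlgHom.id k (H ⊗[k] H)))

/-- `a ⊗ b ⊗ c ↦ f(b) a ⊗ c`. -/
def contr₂ (f : H →ₐ[k] k) : H ⊗[k] (H ⊗[k] H) →ₐ[k] H ⊗[k] H :=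
  Algebra.TensorProduct.map (AlgHom.id k H) (contrFst f)

/-- `a ⊗ b ⊗ c ↦ f(c) a ⊗ b`. -/
def contr₃ (f : H →ₐ[k] k) : H ⊗[k] (H ⊗[k] H) →ₐ[k] H ⊗[k] H :=
  Algebra.TensorProduct.map (AlgHom.id k H) (contrSnd f)

/-- For `D : H → H ⊗ H`, the map `a ⊗ t ↦ a₁ ⊗ a₂ ⊗ t`, where `D a = a₁ ⊗ a₂`. -/
def applyFst {T : Type*} [Ring T] [Algebra k T] (D : H →ₐ[k] H ⊗[k] H) :
    H ⊗[k] T →ₐ[k] H ⊗[k] (H ⊗[k] T) :=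
  (Algebra.TensorProduct.assoc k k k H H T).toAlgHom.comp
    (Algebra.TensorProduct.map D (AlgHom.id k T))

/-- `t ⊗ a ↦ t ⊗ f(a)`. -/
def applySnd {T U V : Type*} [Ring T] [Algebra k T] [Ring U] [Algebra k U] [Ring V] [Algebra k V]
    (f : U →ₐ[k] V) : T ⊗[k] U →ₐ[k] T ⊗[k] V :=
  Algebra.TensorProduct.map (AlgHom.id k T) f

end Contractions

/-- A quasi-bialgebra structure `(Δ, ε, Φ)` on the unital associative `k`-algebra `H`. -/
structure QuasiBialgebra (k H : Type*) [Field k] [Ring H] [Algebra k H] where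
  /-- the comultiplication `Δ` -/
  comul : H →ₐ[k] H ⊗[k] H
  /-- the counit `ε` -/
  counit : H →ₐ[k] k
  /-- the reassociator `Φ`, an invertible element of `H ⊗ H ⊗ H` -/
  Φ : (H ⊗[k] (H ⊗[k] H))ˣ
  /-- `(id ⊗ Δ)(Δ(h)) = Φ (Δ ⊗ id)(Δ(h)) Φ⁻¹` -/
  quasi_coassoc : ∀ h : H,
    applySnd comul (comul h) = ↑Φ * applyFst comul (comul h) * ↑Φ⁻¹
  /-- `(id ⊗ ε)(Δ(h)) = h` -/
  counit_snd : ∀ h : H, contrSnd counit (comul h) = h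
  /-- `(ε ⊗ id)(Δ(h)) = h` -/
  counit_fst : ∀ h : H, contrFst counit (comul h) = h
  /-- `(id ⊗ ε ⊗ id)(Φ) = 1 ⊗ 1` -/
  normalized : contr₂ counit (Φ : H ⊗[k] (H ⊗[k] H)) = 1
  /-- `(1 ⊗ Φ) (id ⊗ Δ ⊗ id)(Φ) (Φ ⊗ 1) = (id ⊗ id ⊗ Δ)(Φ) (Δ ⊗ id ⊗ id)(Φ)` -/
  pentagon :
    ((1 : H) ⊗ₜ[k] (Φ : H ⊗[k] (H ⊗[k] H))) *
        applySnd (applyFst comul) (Φ : H ⊗[k] (H ⊗[k] H)) *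
        applySnd (applySnd Algebra.TensorProduct.includeLeft) (Φ : H ⊗[k] (H ⊗[k] H)) =
      applySnd (applySnd comul) (Φ : H ⊗[k] (H ⊗[k] H)) *
        applyFst comul (Φ : H ⊗[k] (H ⊗[k] H))

/-- A quasi-Hopf algebra structure on `H`: a quasi-bialgebra structure together with an
anti-endomorphism `S` of the algebra `H` and elements `α`, `β` of `H`. Bijectivity of `S` is not
part of the definition. -/
structure QuasiHopfAlgebra (k H : Type*) [Field k] [Ring H] [Algebra k H]
    extends QuasiBialgebra k H where
  S : H →ₗ[k] H
  S_one : S 1 = 1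
  S_mul : ∀ a b : H, S (a * b) = S b * S a
  α : H
  β : H
  /-- `S(h₁) α h₂ = ε(h) α` -/
  S_alpha : ∀ h : H,
    LinearMap.mul' k H (TensorProduct.map (LinearMap.mulRight k α ∘ₗ S) LinearMap.id (comul h)) =
      counit h • α
  /-- `h₁ β S(h₂) = ε(h) β` -/
  beta_S : ∀ h : H,
    LinearMap.mul' k H (TensorProduct.map (LinearMap.mulRight k β) S (comul h)) = counit h • β
  /-- `X¹ β S(X²) α X³ = 1`, where `Φ = X¹ ⊗ X² ⊗ X³` -/
  Φ_antipode :
    LinearMap.mul' k H (TensorProduct.map (LinearMap.mulRight k β)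
      (LinearMap.mul' k H ∘ₗ TensorProduct.map (LinearMap.mulRight k α ∘ₗ S) LinearMap.id)
      (Φ : H ⊗[k] (H ⊗[k] H))) = 1
  /-- `S(x¹) α x² β S(x³) = 1`, where `Φ⁻¹ = x¹ ⊗ x² ⊗ x³` -/
  Φinv_antipode :
    LinearMap.mul' k H (TensorProduct.map (LinearMap.mulRight k α ∘ₗ S)
      (LinearMap.mul' k H ∘ₗ TensorProduct.map (LinearMap.mulRight k β) S)
      (↑Φ⁻¹ : H ⊗[k] (H ⊗[k] H))) = 1

/-! ### Actions, associativity constraint and braiding -/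

section Actions

variable {k H : Type*} [Field k] [Ring H] [Algebra k H]

/-- The action `(a ⊗ c) · (m ⊗ n) = a · m ⊗ c · n` of `A ⊗ C` on `M ⊗ N`. -/
def actTensor {A C M N : Type*} [Ring A] [Algebra k A] [Ring C] [Algebra k C]
    [AddCommGroup M] [Module k M] [AddCommGroup N] [Module k N]
    (a : A →ₐ[k] Module.End k M) (c : C →ₐ[k] Module.End k N) :
    A ⊗[k] C →ₐ[k] Module.End k (M ⊗[k] N) :=
  (Module.endTensorEndAlgHom (R := k) (S := k) (A := k)).comp (Algebra.TensorProduct.map a c)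

/-- The map `m ⊗ n ↦ m₍₋₁₎ · n ⊗ m₍₀₎`, for a map `coact m = m₍₋₁₎ ⊗ m₍₀₎` from `M` to `H ⊗ M`
and a left `H`-module `N`. -/
def braid {M N : Type*} [AddCommGroup M] [Module k M] [AddCommGroup N] [Module k N]
    (coact : M →ₗ[k] H ⊗[k] M) (c : H →ₐ[k] Module.End k N) :
    M ⊗[k] N →ₗ[k] N ⊗[k] M :=
  TensorProduct.map (TensorProduct.lift c.toLinearMap) LinearMap.id ∘ₗ
    (TensorProduct.rightComm k H M N).toLinearMap ∘ₗ
    TensorProduct.map coact LinearMap.id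

variable (Q : QuasiBialgebra k H)

variable {M N P : Type*} [AddCommGroup M] [Module k M] [AddCommGroup N] [Module k N]
  [AddCommGroup P] [Module k P]

/-- The associativity constraint of the category of left `H`-modules:
`(m ⊗ n) ⊗ p ↦ X¹ · m ⊗ (X² · n ⊗ X³ · p)`, where `Φ = X¹ ⊗ X² ⊗ X³`. -/
def assocΦ (a : H →ₐ[k] Module.End k M) (b : H →ₐ[k] Module.End k N)
    (c : H →ₐ[k] Module.End k P) : (M ⊗[k] N) ⊗[k] P →ₗ[k] M ⊗[k] (N ⊗[k] P) :=
  actTensor a (actTensor b c) (Q.Φ : H ⊗[k] (H ⊗[k] H)) ∘ₗ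
    (TensorProduct.assoc k M N P).toLinearMap

/-- The inverse associativity constraint:
`m ⊗ (n ⊗ p) ↦ (x¹ · m ⊗ x² · n) ⊗ x³ · p`, where `Φ⁻¹ = x¹ ⊗ x² ⊗ x³`. -/
def assocΦInv (a : H →ₐ[k] Module.End k M) (b : H →ₐ[k] Module.End k N)
    (c : H →ₐ[k] Module.End k P) : M ⊗[k] (N ⊗[k] P) →ₗ[k] (M ⊗[k] N) ⊗[k] P :=
  (TensorProduct.assoc k M N P).symm.toLinearMap ∘ₗ
    actTensor a (actTensor b c) (↑Q.Φ⁻¹ : H ⊗[k] (H ⊗[k] H))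

/-- The diagonal action `h · (m ⊗ n) = h₁ · m ⊗ h₂ · n`. -/
def actDiag (a : H →ₐ[k] Module.End k M) (b : H →ₐ[k] Module.End k N) :
    H →ₐ[k] Module.End k (M ⊗[k] N) :=
  (actTensor a b).comp Q.comul

/-- The coaction on the tensor product of two Yetter–Drinfeld modules:
`m ⊗ n ↦ X¹ (x¹Y¹ · m)₍₋₁₎ x² (Y² · n)₍₋₁₎ Y³ ⊗ (X² · (x¹Y¹ · m)₍₀₎ ⊗ X³x³ · (Y² · n)₍₀₎)`,
where `Φ = X¹ ⊗ X² ⊗ X³ = Y¹ ⊗ Y² ⊗ Y³` and `Φ⁻¹ = x¹ ⊗ x² ⊗ x³`. -/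
def coactTensor (a : H →ₐ[k] Module.End k M) (lM : M →ₗ[k] H ⊗[k] M)
    (b : H →ₐ[k] Module.End k N) (lN : N →ₗ[k] H ⊗[k] N) :
    M ⊗[k] N →ₗ[k] H ⊗[k] (M ⊗[k] N) :=
  let L : H →ₐ[k] Module.End k H := Algebra.lmul k H
  assocΦ Q L a b ∘ₗ
    TensorProduct.map (braid lM L) LinearMap.id ∘ₗ
    assocΦInv Q a L b ∘ₗ
    TensorProduct.map LinearMap.id (braid lN L) ∘ₗ
    assocΦ Q a b L ∘ₗ
    (TensorProduct.mk k (M ⊗[k] N) H).flip 1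

/-- The multiplication of the braided tensor product algebra `B ⊗ B`, that is
`(B ⊗ B) ⊗ (B ⊗ B) → B ⊗ (B ⊗ (B ⊗ B)) → B ⊗ ((B ⊗ B) ⊗ B) → B ⊗ ((B ⊗ B) ⊗ B)
  → B ⊗ (B ⊗ (B ⊗ B)) → (B ⊗ B) ⊗ (B ⊗ B) → B ⊗ B`, the third map being given by the braiding of
the two inner factors. It sends `(b ⊗ d) ⊗ (b' ⊗ d')` to
`(y¹X¹ · b) (y²Y¹ (x¹X² · d)₍₋₁₎ x²X³₁ · b') ⊗ (y³₁Y² · (x¹X² · d)₍₀₎) (y³₂Y³x³X³₂ · d')`. -/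
def mulTensor (a : H →ₐ[k] Module.End k M) (l : M →ₗ[k] H ⊗[k] M) (mul : M ⊗[k] M →ₗ[k] M) :
    (M ⊗[k] M) ⊗[k] (M ⊗[k] M) →ₗ[k] M ⊗[k] M :=
  TensorProduct.map mul mul ∘ₗ
    assocΦInv Q a a (actDiag Q a a) ∘ₗ
    TensorProduct.map LinearMap.id (assocΦ Q a a a) ∘ₗ
    TensorProduct.map LinearMap.id (TensorProduct.map (braid l a) LinearMap.id) ∘ₗ
    TensorProduct.map LinearMap.id (assocΦInv Q a a a) ∘ₗ
    assocΦ Q a a (actDiag Q a a)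

end Actions

/-! ### Hopf algebras in the category of Yetter–Drinfeld modules -/

/-- The data of a left `H`-module `B` with linear maps
`B → H ⊗ B`, `B ⊗ B → B`, `B → B ⊗ B`, `B → k`, `B → B` and an element of `B`. -/
structure BraidedHopfData (k H B : Type*) [Field k] [Ring H] [Algebra k H]
    [AddCommGroup B] [Module k B] where
  act : H →ₐ[k] Module.End k B
  coact : B →ₗ[k] H ⊗[k] B
  mul : B ⊗[k] B →ₗ[k] B
  one : B
  comul : B →ₗ[k] B ⊗[k] B
  counit : B →ₗ[k] k
  antipode : B →ₗ[k] B

namespace BraidedHopfData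

variable {k H B C : Type*} [Field k] [Ring H] [Algebra k H]
  [AddCommGroup B] [Module k B] [AddCommGroup C] [Module k C]

/-- `B` is a left Yetter–Drinfeld module over `H`. -/
structure IsYDModule (Q : QuasiBialgebra k H) (D : BraidedHopfData k H B) : Prop where
  /-- `ε(m₍₋₁₎) m₍₀₎ = m` -/
  counit_coact : ∀ m : B,
    TensorProduct.lid k B (TensorProduct.map Q.counit.toLinearMap LinearMap.id (D.coact m)) = m
  /-- `X¹ m₍₋₁₎ ⊗ (X² · m₍₀₎)₍₋₁₎ X³ ⊗ (X² · m₍₀₎)₍₀₎ =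
  X¹ (Y¹ · m)₍₋₁₎₁ Y² ⊗ X² (Y¹ · m)₍₋₁₎₂ Y³ ⊗ X³ · (Y¹ · m)₍₀₎` -/
  coact_coassoc : ∀ m : B,
    TensorProduct.map LinearMap.id (braid D.coact (Algebra.lmul k H))
        (assocΦ Q (Algebra.lmul k H) D.act (Algebra.lmul k H) (D.coact m ⊗ₜ[k] (1 : H))) =
      assocΦ Q (Algebra.lmul k H) (Algebra.lmul k H) D.act
        (braid D.coact (actDiag Q (Algebra.lmul k H) (Algebra.lmul k H))
          (assocΦ Q D.act (Algebra.lmul k H) (Algebra.lmul k H)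
            ((m ⊗ₜ[k] (1 : H)) ⊗ₜ[k] (1 : H))))
  /-- `h₁ m₍₋₁₎ ⊗ h₂ · m₍₀₎ = (h₁ · m)₍₋₁₎ h₂ ⊗ (h₁ · m)₍₀₎` -/
  act_coact : ∀ (h : H) (m : B),
    actDiag Q (Algebra.lmul k H) D.act h (D.coact m) =
      braid D.coact (Algebra.lmul k H) (actDiag Q D.act (Algebra.lmul k H) h (m ⊗ₜ[k] (1 : H)))

/-- `B` is an algebra in the category of left Yetter–Drinfeld modules. -/
structure IsYDAlgebra (Q : QuasiBialgebra k H) (D : BraidedHopfData k H B) : Prop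
    extends D.IsYDModule Q where
  one_mul : ∀ b : B, D.mul (D.one ⊗ₜ[k] b) = b
  mul_one : ∀ b : B, D.mul (b ⊗ₜ[k] D.one) = b
  act_mul : ∀ (h : H) (t : B ⊗[k] B), D.act h (D.mul t) = D.mul (actDiag Q D.act D.act h t)
  act_one : ∀ h : H, D.act h D.one = Q.counit h • D.one
  /-- `(b b') b'' = (X¹ · b) [(X² · b') (X³ · b'')]` -/
  mul_assoc : ∀ t : (B ⊗[k] B) ⊗[k] B,
    D.mul (TensorProduct.map D.mul LinearMap.id t) =
      D.mul (TensorProduct.map LinearMap.id D.mul (assocΦ Q D.act D.act D.act t))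
  coact_mul : ∀ t : B ⊗[k] B,
    D.coact (D.mul t) =
      TensorProduct.map LinearMap.id D.mul (coactTensor Q D.act D.coact D.act D.coact t)
  coact_one : D.coact D.one = 1 ⊗ₜ[k] D.one

/-- `B` is a coalgebra in the category of left Yetter–Drinfeld modules. -/
structure IsYDCoalgebra (Q : QuasiBialgebra k H) (D : BraidedHopfData k H B) : Prop
    extends D.IsYDModule Q where
  counit_fst : ∀ b : B,
    TensorProduct.lid k B (TensorProduct.map D.counit LinearMap.id (D.comul b)) = b
  counit_snd : ∀ b : B,
    TensorProduct.rid k B (TensorProduct.map LinearMap.id D.counit (D.comul b)) = b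
  act_comul : ∀ (h : H) (b : B), D.comul (D.act h b) = actDiag Q D.act D.act h (D.comul b)
  act_counit : ∀ (h : H) (b : B), D.counit (D.act h b) = Q.counit h * D.counit b
  /-- `X¹ · b₁₁ ⊗ X² · b₁₂ ⊗ X³ · b₂ = b₁ ⊗ b₂₁ ⊗ b₂₂` -/
  coassoc : ∀ b : B,
    assocΦ Q D.act D.act D.act (TensorProduct.map D.comul LinearMap.id (D.comul b)) =
      TensorProduct.map LinearMap.id D.comul (D.comul b)
  coact_comul : ∀ b : B,
    TensorProduct.map LinearMap.id D.comul (D.coact b) =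
      coactTensor Q D.act D.coact D.act D.coact (D.comul b)
  /-- `ε_B(b₍₀₎) b₍₋₁₎ = ε_B(b) 1` -/
  coact_counit : ∀ b : B,
    TensorProduct.rid k H (TensorProduct.map LinearMap.id D.counit (D.coact b)) =
      D.counit b • (1 : H)

/-- `B` is a bialgebra in the category of left Yetter–Drinfeld modules. -/
structure IsYDBialgebra (Q : QuasiBialgebra k H) (D : BraidedHopfData k H B) : Prop
    extends D.IsYDAlgebra Q, D.IsYDCoalgebra Q where
  comul_one : D.comul D.one = D.one ⊗ₜ[k] D.one
  counit_one : D.counit D.one = 1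
  counit_mul : ∀ b c : B, D.counit (D.mul (b ⊗ₜ[k] c)) = D.counit b * D.counit c
  comul_mul : ∀ b c : B,
    D.comul (D.mul (b ⊗ₜ[k] c)) = mulTensor Q D.act D.coact D.mul (D.comul b ⊗ₜ[k] D.comul c)

/-- `B` is a Hopf algebra in the category of left Yetter–Drinfeld modules. -/
structure IsYDHopfAlgebra (Q : QuasiBialgebra k H) (D : BraidedHopfData k H B) : Prop
    extends D.IsYDBialgebra Q where
  act_antipode : ∀ (h : H) (b : B), D.antipode (D.act h b) = D.act h (D.antipode b)
  coact_antipode : ∀ b : B,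
    D.coact (D.antipode b) = TensorProduct.map LinearMap.id D.antipode (D.coact b)
  antipode_fst : ∀ b : B,
    D.mul (TensorProduct.map D.antipode LinearMap.id (D.comul b)) = D.counit b • D.one
  antipode_snd : ∀ b : B,
    D.mul (TensorProduct.map LinearMap.id D.antipode (D.comul b)) = D.counit b • D.one

/-- Isomorphism of Hopf algebras in the category of left Yetter–Drinfeld modules: an `H`-linear and
`H`-colinear bijection compatible with all the structure maps. -/
def Isomorphic (D : BraidedHopfData k H B) (E : BraidedHopfData k H C) : Prop :=
  ∃ f : B ≃ₗ[k] C,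
    (∀ (h : H) (b : B), f (D.act h b) = E.act h (f b)) ∧
    (∀ b : B, E.coact (f b) = TensorProduct.map LinearMap.id f.toLinearMap (D.coact b)) ∧
    (∀ b c : B, f (D.mul (b ⊗ₜ[k] c)) = E.mul (f b ⊗ₜ[k] f c)) ∧
    f D.one = E.one ∧
    (∀ b : B, E.comul (f b) = TensorProduct.map f.toLinearMap f.toLinearMap (D.comul b)) ∧
    (∀ b : B, E.counit (f b) = D.counit b) ∧
    (∀ b : B, f (D.antipode b) = E.antipode (f b))

end BraidedHopfData

/-! ### The two kinds of braided Hopf algebras of dimension two -/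

section Examples

variable {k H : Type*} [Field k] [Ring H] [Algebra k H]

/-- The conditions on the couple `(σ, v)`. -/
structure IsAdmissiblePair (Q : QuasiBialgebra k H) (σ : H →ₐ[k] k) (v : H) : Prop where
  map_v : σ v = -1
  counit_v : Q.counit v = 1
  /-- `Δ(v) = σ(x³X²y¹) x¹X¹vy² ⊗ x²vX³y³`, where `Φ = X¹ ⊗ X² ⊗ X³` and
  `Φ⁻¹ = x¹ ⊗ x² ⊗ x³ = y¹ ⊗ y² ⊗ y³` -/
  comul_v : Q.comul v =
    contr₃ σ (↑Q.Φ⁻¹ : H ⊗[k] (H ⊗[k] H)) *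
      ((1 ⊗ₜ[k] v) * contr₂ σ (Q.Φ : H ⊗[k] (H ⊗[k] H)) * (v ⊗ₜ[k] 1)) *
      contr₁ σ (↑Q.Φ⁻¹ : H ⊗[k] (H ⊗[k] H))
  /-- `σ(h₂) h₁ v = σ(h₁) v h₂` -/
  comm_v : ∀ h : H, contrSnd σ (Q.comul h) * v = v * contrFst σ (Q.comul h)

/-- On the dual numbers `k[n]/(n²)` with basis `1, n`, the linear map `1 ↦ x`, `n ↦ y`. -/
def dualLift {V : Type*} [AddCommGroup V] [Module k V] (x y : V) : DualNumber k →ₗ[k] V :=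
  LinearMap.toSpanSingleton k V x ∘ₗ (TrivSqZeroExt.fstHom k k k).toLinearMap +
    LinearMap.toSpanSingleton k V y ∘ₗ TrivSqZeroExt.sndHom k k

theorem dualLift_apply {V : Type*} [AddCommGroup V] [Module k V] (x y : V) (b : DualNumber k) :
    dualLift x y b = b.fst • x + b.snd • y := by
  simp [dualLift]

/-- The action `h · 1 = ε(h) 1`, `h · n = σ(h) n` on `k[n]/(n²)`. -/
def dualAct (ε σ : H →ₐ[k] k) : H →ₐ[k] Module.End k (DualNumber k) where
  toFun h := dualLift (ε h • (1 : DualNumber k)) (σ h • DualNumber.eps)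
  map_one' := by
    ext b <;> simp [dualLift_apply]
  map_mul' h h' := by
    ext b <;> simp [dualLift_apply] <;> ring
  map_zero' := by
    ext b <;> simp [dualLift_apply]
  map_add' h h' := by
    ext b <;> simp [dualLift_apply] <;> ring
  commutes' c := by
    ext b <;> simp [dualLift_apply] <;> ring

/-- The data `B_{σ,v}` on the algebra `k[n]/(n²)`: `h · 1 = ε(h) 1`, `h · n = σ(h) n`; coaction
`1 ↦ 1 ⊗ 1`, `n ↦ v ⊗ n`; `Δ(1) = 1 ⊗ 1`, `Δ(n) = n ⊗ 1 + 1 ⊗ n`; `ε(1) = 1`, `ε(n) = 0`;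
`S(1) = 1`, `S(n) = -n`. -/
def braidedB (Q : QuasiBialgebra k H) (σ : H →ₐ[k] k) (v : H) :
    BraidedHopfData k H (DualNumber k) where
  act := dualAct Q.counit σ
  coact := dualLift (1 ⊗ₜ[k] 1) (v ⊗ₜ[k] DualNumber.eps)
  mul := LinearMap.mul' k (DualNumber k)
  one := 1
  comul := dualLift (1 ⊗ₜ[k] 1) (DualNumber.eps ⊗ₜ[k] 1 + 1 ⊗ₜ[k] DualNumber.eps)
  counit := dualLift 1 0
  antipode := dualLift 1 (-DualNumber.eps)

/-- The group Hopf algebra `k[C₂]` with the trivial action `h · b = ε(h) b` and the trivial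
coaction `b ↦ 1 ⊗ b`. -/
def trivialC₂ (Q : QuasiBialgebra k H) :
    BraidedHopfData k H (MonoidAlgebra k (Multiplicative (ZMod 2))) where
  act := (Algebra.ofId k (Module.End k (MonoidAlgebra k (Multiplicative (ZMod 2))))).comp Q.counit
  coact := TensorProduct.mk k H (MonoidAlgebra k (Multiplicative (ZMod 2))) 1
  mul := LinearMap.mul' k (MonoidAlgebra k (Multiplicative (ZMod 2)))
  one := 1
  comul := Coalgebra.comul
  counit := Coalgebra.counit
  antipode := HopfAlgebra.antipode k

end Examples

end

/-! Let `B` be a two-dimensional Hopf algebra in the Yetter–Drinfeld category. Its unit `1` and a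
generator `n` of the kernel of its counit form a basis. The counit is multiplicative, `H`-linear and
`H`-colinear, so its kernel is an ideal and a subobject: `h · n = σ(h) n` for a character `σ`, `n ↦
v ⊗ n`, and `n² = c n`. The counit axioms give `Δ(n) = n ⊗ 1 + 1 ⊗ n + μ n ⊗ n`, and the antipode
axiom gives `S(n) = s n` with `1 + s(1 + cμ) = 0`.

Every basis vector is an eigenvector of `H`, so `Φ` acts on tensors of basis vectors by scalars, and
the scalar is `1` as soon as one factor is the unit. This needs `Φ` to be normalised in all three
slots; the pentagon yields the two outer ones (`contr₁_counit_Φ`, `contr₃_counit_Φ`). The scalar on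
`n ⊗ n ⊗ n` never has to be known.

If `c` or `μ` is nonzero, `H`-linearity of the product or coproduct gives `σ * σ = σ` for
convolution. Since `σ ∘ S` is a left convolution inverse of `σ`, this forces `σ = ε`
(`eq_counit_of_conv_self`). Hence for `σ ≠ ε` both `c` and `μ` vanish, `s = -1`, and the coefficient
of `n ⊗ n` in `Δ(n²) = Δ(n)Δ(n)` gives `σ(v) = -1`: this is `B_{σ,v}`.

If `σ = ε`, the same coefficient gives `(1 + cμ)(2 + cμ) = 0`. The antipode excludes the first
factor, so `cμ = -2`, which is nonzero in characteristic different from `2`, and `s = 1`.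
Colinearity of the product makes `v` idempotent; being central and group-like, it equals `1`
(`eq_one_of_isYDPair_counit`). The result is `k[C₂]` with `n = (c/2)(1 - g)`.

Conversely, the axioms for `B_{σ,v}` are checked on the basis, where `σ(v) = -1` enters only through
`Δ(n)Δ(n) = 0`. For `k[C₂]` all constraints are trivial and the axioms are those of the ordinary
Hopf algebra. -/

noncomputable section

/-! ### Characters and contractions -/

section Characters

variable {k A C : Type*} [Field k] [Ring A] [Algebra k A] [Ring C] [Algebra k C]

/-- The character `a ⊗ c ↦ χ(a) ψ(c)`. -/
def tensorChar (χ : A →ₐ[k] k) (ψ : C →ₐ[k] k) : A ⊗[k] C →ₐ[k] k :=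
  (Algebra.TensorProduct.lmul' k).comp (Algebra.TensorProduct.map χ ψ)

@[simp] theorem tensorChar_tmul (χ : A →ₐ[k] k) (ψ : C →ₐ[k] k) (a : A) (c : C) :
    tensorChar χ ψ (a ⊗ₜ c) = χ a * ψ c := by
  simp [tensorChar]

/-- `a ⊗ c ↦ χ(a) c`. -/
def contrLeft (χ : A →ₐ[k] k) : A ⊗[k] C →ₐ[k] C :=
  (Algebra.TensorProduct.lid k C).toAlgHom.comp
    (Algebra.TensorProduct.map χ (AlgHom.id k C))

/-- `a ⊗ c ↦ ψ(c) a`. -/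
def contrRight (ψ : C →ₐ[k] k) : A ⊗[k] C →ₐ[k] A :=
  (Algebra.TensorProduct.rid k k A).toAlgHom.comp
    (Algebra.TensorProduct.map (AlgHom.id k A) ψ)

@[simp] theorem contrLeft_tmul (χ : A →ₐ[k] k) (a : A) (c : C) :
    contrLeft χ (a ⊗ₜ[k] c) = χ a • c := by
  simp [contrLeft]

@[simp] theorem contrRight_tmul (ψ : C →ₐ[k] k) (a : A) (c : C) :
    contrRight ψ (a ⊗ₜ[k] c) = ψ c • a := by
  simp [contrRight]

variable {H : Type*} [Ring H] [Algebra k H]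

@[simp] theorem contrFst_tmul (χ : H →ₐ[k] k) (a b : H) : contrFst χ (a ⊗ₜ b) = χ a • b := by
  simp [contrFst]

@[simp] theorem contrSnd_tmul (χ : H →ₐ[k] k) (a b : H) : contrSnd χ (a ⊗ₜ b) = χ b • a := by
  simp [contrSnd]

@[simp] theorem contr₁_tmul (χ : H →ₐ[k] k) (a : H) (t : H ⊗[k] H) :
    contr₁ χ (a ⊗ₜ t) = χ a • t := by
  simp [contr₁]

@[simp] theorem contr₂_tmul (χ : H →ₐ[k] k) (a : H) (t : H ⊗[k] H) :
    contr₂ χ (a ⊗ₜ t) = a ⊗ₜ contrFst χ t := by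
  simp [contr₂]

@[simp] theorem contr₃_tmul (χ : H →ₐ[k] k) (a : H) (t : H ⊗[k] H) :
    contr₃ χ (a ⊗ₜ t) = a ⊗ₜ contrSnd χ t := by
  simp [contr₃]

@[simp] theorem applySnd_tmul {T U V : Type*} [Ring T] [Algebra k T] [Ring U] [Algebra k U]
    [Ring V] [Algebra k V] (f : U →ₐ[k] V) (t : T) (u : U) :
    applySnd f (t ⊗ₜ[k] u) = t ⊗ₜ f u := by
  simp [applySnd]

theorem applyFst_tmul {T : Type*} [Ring T] [Algebra k T] (D : H →ₐ[k] H ⊗[k] H) (h : H) (t : T) :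
    applyFst D (h ⊗ₜ[k] t) = TensorProduct.assoc k H H T (D h ⊗ₜ t) := by
  simp [applyFst]
  rfl

/-- These factorisations evaluate products of characters on `Φ` through a contraction of one slot;
when the contracted character is the counit, normalisation makes the value `1`. -/
theorem tensorChar_eq_contr₁ (ε ψ ρ : H →ₐ[k] k) :
    tensorChar ε (tensorChar ψ ρ) = (tensorChar ψ ρ).comp (contr₁ ε) := by
  ext <;> simp

theorem tensorChar_eq_contr₂ (χ ε ρ : H →ₐ[k] k) :
    tensorChar χ (tensorChar ε ρ) = (tensorChar χ ρ).comp (contr₂ ε) := by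
  ext <;> simp

theorem tensorChar_eq_contr₃ (χ ψ ε : H →ₐ[k] k) :
    tensorChar χ (tensorChar ψ ε) = (tensorChar χ ψ).comp (contr₃ ε) := by
  ext <;> simp

theorem contrRight_tensorChar_eq_contr₂ (ε ψ : H →ₐ[k] k) :
    contrRight (A := H) (tensorChar ε ψ) = (contrSnd ψ).comp (contr₂ ε) := by
  ext <;> simp

theorem contrRight_tensorChar_eq_contr₃ (χ ε : H →ₐ[k] k) :
    contrRight (A := H) (tensorChar χ ε) = (contrSnd χ).comp (contr₃ ε) := by
  ext <;> simp

theorem contrFst_contr₃ (ε ψ : H →ₐ[k] k) :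
    (contrFst ε).comp (contr₃ ψ) = (contrSnd ψ).comp (contr₁ ε) := by
  ext <;> simp

theorem contrFst_contr₁ (χ ε : H →ₐ[k] k) :
    (contrFst ε).comp (contr₁ χ) = (contrFst χ).comp (contr₂ ε) := by
  ext <;> simp

theorem map_units_inv_eq_one {A C : Type*} [Ring A] [Algebra k A] [Ring C] [Algebra k C]
    (f : A →ₐ[k] C) (u : Aˣ) (h : f u = 1) : f ↑u⁻¹ = 1 := by
  have : f ↑u * f ↑u⁻¹ = 1 := by rw [← map_mul, Units.mul_inv, map_one]
  rwa [h, one_mul] at this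

end Characters

/-! ### Convolution of characters -/

namespace QuasiBialgebra

variable {k H : Type*} [Field k] [Ring H] [Algebra k H] (Q : QuasiBialgebra k H)

/-- The convolution product of two characters of a quasi-bialgebra. -/
def conv (χ ψ : H →ₐ[k] k) : H →ₐ[k] k := (tensorChar χ ψ).comp Q.comul

theorem conv_apply (χ ψ : H →ₐ[k] k) (h : H) : Q.conv χ ψ h = tensorChar χ ψ (Q.comul h) := rfl

@[simp] theorem conv_counit (χ : H →ₐ[k] k) : Q.conv χ Q.counit = χ := by
  have h : tensorChar χ Q.counit = χ.comp (contrSnd Q.counit) := by ext <;> simp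
  ext a
  rw [conv_apply, h, AlgHom.comp_apply, Q.counit_snd]

@[simp] theorem counit_conv (χ : H →ₐ[k] k) : Q.conv Q.counit χ = χ := by
  have h : tensorChar Q.counit χ = χ.comp (contrFst Q.counit) := by ext <;> simp
  ext a
  rw [conv_apply, h, AlgHom.comp_apply, Q.counit_fst]

/-- Coassociativity fails only by conjugation with `Φ`, and a character with values in a commutative
field does not see conjugation. -/
theorem conv_assoc (χ ψ ρ : H →ₐ[k] k) : Q.conv (Q.conv χ ψ) ρ = Q.conv χ (Q.conv ψ ρ) := by
  have h1 : tensorChar χ (Q.conv ψ ρ) = (tensorChar χ (tensorChar ψ ρ)).comp (applySnd Q.comul) := by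
    ext <;> simp [conv_apply]
  have h0 : ∀ (s : H ⊗[k] H) (c : H), tensorChar χ (tensorChar ψ ρ)
      (TensorProduct.assoc k H H H (s ⊗ₜ c)) = tensorChar χ ψ s * ρ c := by
    intro s c
    induction s with
    | zero => simp
    | tmul x y => simp [mul_assoc]
    | add x y hx hy => simp [TensorProduct.add_tmul, hx, hy, add_mul]
  have h2 : tensorChar (Q.conv χ ψ) ρ = (tensorChar χ (tensorChar ψ ρ)).comp (applyFst Q.comul) := by
    ext <;> simp [conv_apply, applyFst_tmul, h0]
  ext a
  have h3 := congrArg (tensorChar χ (tensorChar ψ ρ)) (Q.quasi_coassoc a)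
  rw [conv_apply, conv_apply, h1, h2, AlgHom.comp_apply, AlgHom.comp_apply, h3, map_mul, map_mul,
    mul_right_comm, ← map_mul, Units.mul_inv, map_one, one_mul]

end QuasiBialgebra

/-! ### Normalisation of the reassociator in the outer slots -/

section Pentagon

variable {k H T U V W : Type*} [Field k] [Ring H] [Algebra k H] [Ring T] [Algebra k T]
  [Ring U] [Algebra k U] [Ring V] [Algebra k V] [Ring W] [Algebra k W]

theorem applySnd_applySnd (f : V →ₐ[k] W) (g : U →ₐ[k] V) (t : T ⊗[k] U) :
    applySnd f (applySnd g t) = applySnd (f.comp g) t := by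
  induction t with
  | zero => simp
  | tmul x y => simp
  | add x y hx hy => simp [hx, hy]

theorem applySnd_id (t : T ⊗[k] U) : applySnd (AlgHom.id k U) t = t := by
  simp [applySnd]

theorem contrLeft_assoc (χ : H →ₐ[k] k) (s : H ⊗[k] H) (t : T) :
    contrLeft χ (TensorProduct.assoc k H H T (s ⊗ₜ t)) = contrFst χ s ⊗ₜ t := by
  induction s with
  | zero => simp
  | tmul x y => simp [TensorProduct.smul_tmul']
  | add x y hx hy => simp [TensorProduct.add_tmul, hx, hy]

theorem applySnd_contrLeft_assoc (χ : H →ₐ[k] k) (s : H ⊗[k] H) (t : T) :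
    applySnd (contrLeft χ) (TensorProduct.assoc k H H T (s ⊗ₜ t)) = contrSnd χ s ⊗ₜ t := by
  induction s with
  | zero => simp
  | tmul x y => simp [TensorProduct.smul_tmul]
  | add x y hx hy => simp [TensorProduct.add_tmul, hx, hy]

theorem applySnd_applySnd_assoc (f : T →ₐ[k] U) (s : H ⊗[k] H) (t : T) :
    applySnd (applySnd f) (TensorProduct.assoc k H H T (s ⊗ₜ t)) =
      TensorProduct.assoc k H H U (s ⊗ₜ f t) := by
  induction s with
  | zero => simp
  | tmul x y => simp
  | add x y hx hy => simp [TensorProduct.add_tmul, hx, hy]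

theorem applySnd_applySnd_applyFst (f : T →ₐ[k] U) (D : H →ₐ[k] H ⊗[k] H) (t : H ⊗[k] T) :
    applySnd (applySnd f) (applyFst D t) = applyFst D (applySnd f t) := by
  induction t with
  | zero => simp
  | tmul x y => simp [applyFst_tmul, applySnd_applySnd_assoc]
  | add x y hx hy => simp [hx, hy]

end Pentagon

namespace QuasiBialgebra

variable {k H T : Type*} [Field k] [Ring H] [Algebra k H] [Ring T] [Algebra k T]
  (Q : QuasiBialgebra k H)

theorem contrLeft_counit_applyFst (t : H ⊗[k] T) :
    contrLeft Q.counit (applyFst Q.comul t) = t := by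
  induction t with
  | zero => simp
  | tmul x y => rw [applyFst_tmul, contrLeft_assoc, Q.counit_fst]
  | add x y hx hy => simp [hx, hy]

theorem applySnd_contrLeft_counit_applyFst (t : H ⊗[k] T) :
    applySnd (contrLeft Q.counit) (applyFst Q.comul t) = t := by
  induction t with
  | zero => simp
  | tmul x y => rw [applyFst_tmul, applySnd_contrLeft_assoc, Q.counit_snd]
  | add x y hx hy => simp [hx, hy]

theorem applySnd_contrLeft_counit_Φ :
    applySnd (contrLeft Q.counit) (Q.Φ : H ⊗[k] (H ⊗[k] H)) = 1 :=
  Q.normalized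

/-- Contract the second of the four slots of the pentagon with the counit. The middle-slot
normalisation kills two of the five factors, leaving `(1 ⊗ (ε ⊗ id ⊗ id)(Φ)) Φ = Φ`, and `Φ` is
invertible. -/
theorem contr₁_counit_Φ : contr₁ Q.counit (Q.Φ : H ⊗[k] (H ⊗[k] H)) = 1 := by
  have e1 : (contrLeft Q.counit).comp (applyFst Q.comul) = AlgHom.id k (H ⊗[k] H) :=
    AlgHom.ext Q.contrLeft_counit_applyFst
  have e2 : (contrLeft (A := H) (C := H ⊗[k] H) Q.counit).comp
      (applySnd Algebra.TensorProduct.includeLeft) =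
      Algebra.TensorProduct.includeLeft.comp (contrLeft (C := H) Q.counit) := by
    ext <;> simp [TensorProduct.smul_tmul']
  have e3 : (contrLeft (A := H) (C := H ⊗[k] H) Q.counit).comp (applySnd Q.comul) =
      Q.comul.comp (contrLeft Q.counit) := by
    ext <;> simp
  have h := congrArg (applySnd (contrLeft Q.counit)) Q.pentagon
  rw [map_mul, map_mul, map_mul, applySnd_tmul, applySnd_contrLeft_counit_applyFst,
    applySnd_applySnd, applySnd_applySnd, applySnd_applySnd, e1, e2, e3, applySnd_id,
    ← applySnd_applySnd, ← applySnd_applySnd, applySnd_contrLeft_counit_Φ, map_one, map_one,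
    mul_one] at h
  have h' := Q.Φ.mul_left_inj.1 h
  show contrLeft Q.counit (Q.Φ : H ⊗[k] (H ⊗[k] H)) = 1
  simpa using congrArg (contrLeft Q.counit) h'

/-- Contracting the third slot of the pentagon instead leaves `Φ ((id ⊗ id ⊗ ε)(Φ) ⊗ 1) = Φ`. -/
theorem contr₃_counit_Φ : contr₃ Q.counit (Q.Φ : H ⊗[k] (H ⊗[k] H)) = 1 := by
  have e1 : (applySnd (contrLeft Q.counit)).comp (applyFst Q.comul) = AlgHom.id k (H ⊗[k] H) :=
    AlgHom.ext Q.applySnd_contrLeft_counit_applyFst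
  have e2 : (applySnd (contrLeft (A := H) (C := H) Q.counit)).comp
      (applySnd Algebra.TensorProduct.includeLeft) =
      Algebra.TensorProduct.includeLeft.comp (contrSnd (H := H) Q.counit) := by
    ext <;> simp
  have e3 : (applySnd (contrLeft (A := H) (C := H) Q.counit)).comp (applySnd Q.comul) =
      AlgHom.id k (H ⊗[k] H) := by
    ext a
    · simp
    · simpa using congrArg (fun b => (1 : H) ⊗ₜ[k] b) (show contrLeft Q.counit (Q.comul a) = a from Q.counit_fst a)
  have e4 : (contrRight Q.counit).comp Algebra.TensorProduct.includeLeft = AlgHom.id k H := by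
    ext; simp
  have h := congrArg (applySnd (applySnd (contrLeft Q.counit))) Q.pentagon
  rw [map_mul, map_mul, map_mul, applySnd_tmul, applySnd_applySnd_applyFst,
    applySnd_applySnd, applySnd_applySnd, applySnd_applySnd, e1, e2, e3, applySnd_id,
    applySnd_contrLeft_counit_Φ, map_one, mul_one, ← Algebra.TensorProduct.one_def, one_mul] at h
  have h' := Q.Φ.mul_right_inj.1 (h.trans (mul_one _).symm)
  have h'' := congrArg (applySnd (contrRight Q.counit)) h'
  rwa [applySnd_applySnd, ← AlgHom.comp_assoc, e4, AlgHom.id_comp, map_one] at h''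

end QuasiBialgebra

/-! ### Eigenvectors -/

section Eigenvectors

variable {k A C H M N P : Type*} [Field k] [Ring A] [Algebra k A] [Ring C] [Algebra k C]
  [Ring H] [Algebra k H] [AddCommGroup M] [Module k M] [AddCommGroup N] [Module k N]
  [AddCommGroup P] [Module k P]

@[simp] theorem actTensor_tmul_tmul (a : A →ₐ[k] Module.End k M) (c : C →ₐ[k] Module.End k N)
    (x : A) (y : C) (m : M) (n : N) :
    actTensor a c (x ⊗ₜ y) (m ⊗ₜ n) = a x m ⊗ₜ c y n := by
  simp [actTensor]
  rfl

theorem actTensor_tmul_of_left {a : A →ₐ[k] Module.End k M} {χ : A →ₐ[k] k} {m : M}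
    (hm : ∀ x, a x m = χ x • m) (c : C →ₐ[k] Module.End k N) (t : A ⊗[k] C) (n : N) :
    actTensor a c t (m ⊗ₜ n) = m ⊗ₜ c (contrLeft χ t) n := by
  induction t with
  | zero => simp
  | tmul x y => simp [hm, TensorProduct.smul_tmul]
  | add x y hx hy => simp [hx, hy, TensorProduct.tmul_add]

theorem actTensor_tmul_of_right (a : A →ₐ[k] Module.End k M) {c : C →ₐ[k] Module.End k N}
    {ψ : C →ₐ[k] k} {n : N} (hn : ∀ y, c y n = ψ y • n) (t : A ⊗[k] C) (m : M) :
    actTensor a c t (m ⊗ₜ n) = a (contrRight ψ t) m ⊗ₜ n := by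
  induction t with
  | zero => simp
  | tmul x y => simp [hn, TensorProduct.smul_tmul]
  | add x y hx hy => simp [hx, hy, TensorProduct.add_tmul]

theorem actTensor_tmul_of_eigen {a : A →ₐ[k] Module.End k M} {c : C →ₐ[k] Module.End k N}
    {χ : A →ₐ[k] k} {ψ : C →ₐ[k] k} {m : M} {n : N}
    (hm : ∀ x, a x m = χ x • m) (hn : ∀ y, c y n = ψ y • n) (t : A ⊗[k] C) :
    actTensor a c t (m ⊗ₜ n) = tensorChar χ ψ t • (m ⊗ₜ n) := by
  induction t with
  | zero => simp
  | tmul x y => rw [actTensor_tmul_tmul, hm, hn, TensorProduct.smul_tmul_smul, tensorChar_tmul]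
  | add x y hx hy => simp [hx, hy, add_smul]

/-- The regular representation of `A ⊗ C` is the tensor product of the regular representations. -/
theorem actTensor_lmul (t z : A ⊗[k] C) :
    actTensor (Algebra.lmul k A) (Algebra.lmul k C) t z = t * z := by
  induction t with
  | zero => simp
  | tmul x y =>
    induction z with
    | zero => simp
    | tmul u v => simp
    | add u v hu hv => rw [map_add, hu, hv, mul_add]
  | add x y hx hy => simp [hx, hy, add_mul]

theorem braid_tmul_of_coact {l : M →ₗ[k] H ⊗[k] M} {u : H} {m : M} (hm : l m = u ⊗ₜ m)
    (c : H →ₐ[k] Module.End k N) (n : N) : braid l c (m ⊗ₜ n) = c u n ⊗ₜ m := by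
  simp [braid, hm]

variable (Q : QuasiBialgebra k H)

theorem actDiag_of_eigen {a : H →ₐ[k] Module.End k M} {b : H →ₐ[k] Module.End k N}
    {χ ψ : H →ₐ[k] k} {m : M} {n : N}
    (hm : ∀ x, a x m = χ x • m) (hn : ∀ y, b y n = ψ y • n) (h : H) :
    actDiag Q a b h (m ⊗ₜ n) = Q.conv χ ψ h • (m ⊗ₜ n) :=
  actTensor_tmul_of_eigen hm hn _

theorem assocΦ_of_eigen {a : H →ₐ[k] Module.End k M} {b : H →ₐ[k] Module.End k N}
    {c : H →ₐ[k] Module.End k P} {χ ψ ρ : H →ₐ[k] k} {m : M} {n : N} {p : P}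
    (hm : ∀ x, a x m = χ x • m) (hn : ∀ y, b y n = ψ y • n) (hp : ∀ y, c y p = ρ y • p) :
    assocΦ Q a b c ((m ⊗ₜ n) ⊗ₜ p) =
      tensorChar χ (tensorChar ψ ρ) (Q.Φ : H ⊗[k] (H ⊗[k] H)) • (m ⊗ₜ (n ⊗ₜ p)) := by
  rw [← actTensor_tmul_of_eigen hm (actTensor_tmul_of_eigen hn hp)]
  simp [assocΦ]

theorem assocΦInv_of_eigen {a : H →ₐ[k] Module.End k M} {b : H →ₐ[k] Module.End k N}
    {c : H →ₐ[k] Module.End k P} {χ ψ ρ : H →ₐ[k] k} {m : M} {n : N} {p : P}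
    (hm : ∀ x, a x m = χ x • m) (hn : ∀ y, b y n = ψ y • n) (hp : ∀ y, c y p = ρ y • p) :
    assocΦInv Q a b c (m ⊗ₜ (n ⊗ₜ p)) =
      tensorChar χ (tensorChar ψ ρ) (↑Q.Φ⁻¹ : H ⊗[k] (H ⊗[k] H)) • ((m ⊗ₜ n) ⊗ₜ p) := by
  simp [assocΦInv, actTensor_tmul_of_eigen hm (actTensor_tmul_of_eigen hn hp)]

theorem actTensor_lmul_actTensor_of_eigen {a : H →ₐ[k] Module.End k M} {χ : H →ₐ[k] k} {m : M}
    (hm : ∀ x, a x m = χ x • m) {b : H →ₐ[k] Module.End k N} {ψ : H →ₐ[k] k} {n : N}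
    (hn : ∀ x, b x n = ψ x • n) (t : H ⊗[k] (H ⊗[k] H)) (h : H) :
    actTensor a (actTensor (Algebra.lmul k H) b) t (m ⊗ₜ (h ⊗ₜ n)) =
      m ⊗ₜ ((contrFst χ (contr₃ ψ t) * h) ⊗ₜ n) := by
  rw [actTensor_tmul_of_left hm, actTensor_tmul_of_right _ hn]
  have : (contrRight ψ).comp (contrLeft χ) = (contrFst χ).comp (contr₃ (H := H) ψ) := by
    ext <;> simp
  have h' := DFunLike.congr_fun this t
  simp only [AlgHom.comp_apply] at h'
  simp [h']

theorem coactTensor_of_eigen {a : H →ₐ[k] Module.End k M} {l : M →ₗ[k] H ⊗[k] M}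
    {b : H →ₐ[k] Module.End k N} {l' : N →ₗ[k] H ⊗[k] N} {χ ψ : H →ₐ[k] k} {m : M} {n : N}
    {u u' : H} (hm : ∀ x, a x m = χ x • m) (hn : ∀ x, b x n = ψ x • n)
    (hu : l m = u ⊗ₜ m) (hu' : l' n = u' ⊗ₜ n) :
    coactTensor Q a l b l' (m ⊗ₜ n) =
      (contrRight (tensorChar χ ψ) (Q.Φ : H ⊗[k] (H ⊗[k] H)) *
        (u * (contrFst χ (contr₃ ψ (↑Q.Φ⁻¹ : H ⊗[k] (H ⊗[k] H))) *
          (u' * contrFst ψ (contr₁ χ (Q.Φ : H ⊗[k] (H ⊗[k] H))))))) ⊗ₜ[k] (m ⊗ₜ[k] n) := by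
  have e1 : assocΦ Q a b (Algebra.lmul k H) ((m ⊗ₜ n) ⊗ₜ 1) =
      m ⊗ₜ (n ⊗ₜ contrFst ψ (contr₁ χ (Q.Φ : H ⊗[k] (H ⊗[k] H)))) := by
    simp [assocΦ, actTensor_tmul_of_left hm, actTensor_tmul_of_left hn]
    rfl
  simp only [coactTensor, LinearMap.comp_apply, LinearMap.flip_apply, TensorProduct.mk_apply, e1,
    TensorProduct.map_tmul, LinearMap.id_apply, braid_tmul_of_coact hu']
  simp only [assocΦInv, LinearMap.comp_apply, actTensor_lmul_actTensor_of_eigen hm hn]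
  simp [braid_tmul_of_coact hu, assocΦ,
    actTensor_tmul_of_right _ (actTensor_tmul_of_eigen hm hn)]

/-- All three reassociator factors in the general formula are contracted with the counit in some
slot, hence equal `1`; only the product of the two coactions survives. -/
theorem coactTensor_of_eigen_left {a : H →ₐ[k] Module.End k M} {l : M →ₗ[k] H ⊗[k] M}
    {b : H →ₐ[k] Module.End k N} {l' : N →ₗ[k] H ⊗[k] N} {ψ : H →ₐ[k] k} {m : M} {n : N}
    {u u' : H} (hm : ∀ x, a x m = Q.counit x • m) (hn : ∀ x, b x n = ψ x • n)
    (hu : l m = u ⊗ₜ m) (hu' : l' n = u' ⊗ₜ n) :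
    coactTensor Q a l b l' (m ⊗ₜ n) = (u * u') ⊗ₜ[k] (m ⊗ₜ[k] n) := by
  rw [coactTensor_of_eigen Q hm hn hu hu', contrRight_tensorChar_eq_contr₂, AlgHom.comp_apply,
    Q.normalized, ← AlgHom.comp_apply (contrFst Q.counit), contrFst_contr₃, AlgHom.comp_apply,
    map_units_inv_eq_one _ _ Q.contr₁_counit_Φ, Q.contr₁_counit_Φ]
  simp

theorem coactTensor_of_eigen_right {a : H →ₐ[k] Module.End k M} {l : M →ₗ[k] H ⊗[k] M}
    {b : H →ₐ[k] Module.End k N} {l' : N →ₗ[k] H ⊗[k] N} {χ : H →ₐ[k] k} {m : M} {n : N}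
    {u u' : H} (hm : ∀ x, a x m = χ x • m) (hn : ∀ x, b x n = Q.counit x • n)
    (hu : l m = u ⊗ₜ m) (hu' : l' n = u' ⊗ₜ n) :
    coactTensor Q a l b l' (m ⊗ₜ n) = (u * u') ⊗ₜ[k] (m ⊗ₜ[k] n) := by
  rw [coactTensor_of_eigen Q hm hn hu hu', contrRight_tensorChar_eq_contr₃, AlgHom.comp_apply,
    Q.contr₃_counit_Φ, map_units_inv_eq_one _ _ Q.contr₃_counit_Φ,
    ← AlgHom.comp_apply (contrFst Q.counit), contrFst_contr₁, AlgHom.comp_apply, Q.normalized]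
  simp

/-- The scalar by which the braided tensor product multiplication of eigenvectors differs from the
product of the factors: the eigenvectors have characters `χ₁, χ₂, χ₃, χ₄` and the second one has
coaction `m ↦ u ⊗ m`. -/
def mulTensorScalar (χ₁ χ₂ χ₃ χ₄ : H →ₐ[k] k) (u : H) : k :=
  tensorChar χ₁ (tensorChar χ₂ (Q.conv χ₃ χ₄)) (Q.Φ : H ⊗[k] (H ⊗[k] H)) *
    tensorChar χ₂ (tensorChar χ₃ χ₄) (↑Q.Φ⁻¹ : H ⊗[k] (H ⊗[k] H)) * χ₃ u *
    tensorChar χ₃ (tensorChar χ₂ χ₄) (Q.Φ : H ⊗[k] (H ⊗[k] H)) *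
    tensorChar χ₁ (tensorChar χ₃ (Q.conv χ₂ χ₄)) (↑Q.Φ⁻¹ : H ⊗[k] (H ⊗[k] H))

theorem mulTensor_of_eigen {a : H →ₐ[k] Module.End k M} {l : M →ₗ[k] H ⊗[k] M}
    (mul : M ⊗[k] M →ₗ[k] M) {χ₁ χ₂ χ₃ χ₄ : H →ₐ[k] k} {m₁ m₂ m₃ m₄ : M} {u : H}
    (h₁ : ∀ x, a x m₁ = χ₁ x • m₁) (h₂ : ∀ x, a x m₂ = χ₂ x • m₂)
    (h₃ : ∀ x, a x m₃ = χ₃ x • m₃) (h₄ : ∀ x, a x m₄ = χ₄ x • m₄) (hu : l m₂ = u ⊗ₜ m₂) :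
    mulTensor Q a l mul ((m₁ ⊗ₜ m₂) ⊗ₜ (m₃ ⊗ₜ m₄)) =
      mulTensorScalar Q χ₁ χ₂ χ₃ χ₄ u • (mul (m₁ ⊗ₜ m₃) ⊗ₜ mul (m₂ ⊗ₜ m₄)) := by
  simp only [mulTensor, LinearMap.comp_apply, map_smul, TensorProduct.map_tmul, LinearMap.id_apply,
    TensorProduct.tmul_smul, ← TensorProduct.smul_tmul', h₃, mulTensorScalar,
    assocΦ_of_eigen Q h₁ h₂ (actDiag_of_eigen Q h₃ h₄), assocΦInv_of_eigen Q h₂ h₃ h₄,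
    braid_tmul_of_coact hu, assocΦ_of_eigen Q h₃ h₂ h₄,
    assocΦInv_of_eigen Q h₁ h₃ (actDiag_of_eigen Q h₂ h₄), smul_smul, mul_assoc]

end Eigenvectors

/-! ### Scalars of `Φ` and Yetter–Drinfeld pairs -/

namespace QuasiBialgebra

variable {k H : Type*} [Field k] [Ring H] [Algebra k H] (Q : QuasiBialgebra k H)

@[simp] theorem tensorChar_counit_left_Φ (ψ ρ : H →ₐ[k] k) :
    tensorChar Q.counit (tensorChar ψ ρ) (Q.Φ : H ⊗[k] (H ⊗[k] H)) = 1 := by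
  rw [tensorChar_eq_contr₁, AlgHom.comp_apply, Q.contr₁_counit_Φ, map_one]

@[simp] theorem tensorChar_counit_middle_Φ (χ ρ : H →ₐ[k] k) :
    tensorChar χ (tensorChar Q.counit ρ) (Q.Φ : H ⊗[k] (H ⊗[k] H)) = 1 := by
  rw [tensorChar_eq_contr₂, AlgHom.comp_apply, Q.normalized, map_one]

@[simp] theorem tensorChar_counit_right_Φ (χ ψ : H →ₐ[k] k) :
    tensorChar χ (tensorChar ψ Q.counit) (Q.Φ : H ⊗[k] (H ⊗[k] H)) = 1 := by
  rw [tensorChar_eq_contr₃, AlgHom.comp_apply, Q.contr₃_counit_Φ, map_one]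

@[simp] theorem tensorChar_counit_left_Φ_inv (ψ ρ : H →ₐ[k] k) :
    tensorChar Q.counit (tensorChar ψ ρ) (↑Q.Φ⁻¹ : H ⊗[k] (H ⊗[k] H)) = 1 :=
  map_units_inv_eq_one _ _ (by simp)

@[simp] theorem tensorChar_counit_middle_Φ_inv (χ ρ : H →ₐ[k] k) :
    tensorChar χ (tensorChar Q.counit ρ) (↑Q.Φ⁻¹ : H ⊗[k] (H ⊗[k] H)) = 1 :=
  map_units_inv_eq_one _ _ (by simp)

@[simp] theorem tensorChar_counit_right_Φ_inv (χ ψ : H →ₐ[k] k) :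
    tensorChar χ (tensorChar ψ Q.counit) (↑Q.Φ⁻¹ : H ⊗[k] (H ⊗[k] H)) = 1 :=
  map_units_inv_eq_one _ _ (by simp)

/-- The condition on a character `χ` and an element `u` under which the coaction `m ↦ u ⊗ m` on
a module with action `h · m = χ(h) m` is a Yetter–Drinfeld structure. -/
structure IsYDPair (χ : H →ₐ[k] k) (u : H) : Prop where
  counit : Q.counit u = 1
  comul : (1 ⊗ₜ[k] u) * contr₂ χ (Q.Φ : H ⊗[k] (H ⊗[k] H)) * (u ⊗ₜ[k] 1) =
    contr₃ χ (Q.Φ : H ⊗[k] (H ⊗[k] H)) * Q.comul u * contr₁ χ (Q.Φ : H ⊗[k] (H ⊗[k] H))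
  comm : ∀ h : H, contrSnd χ (Q.comul h) * u = u * contrFst χ (Q.comul h)

theorem isYDPair_counit : Q.IsYDPair Q.counit 1 where
  counit := map_one _
  comul := by
    rw [Q.normalized, Q.contr₁_counit_Φ, Q.contr₃_counit_Φ, map_one,
      ← Algebra.TensorProduct.one_def]
  comm h := by rw [Q.counit_fst, Q.counit_snd, one_mul, mul_one]

/-- The contractions are algebra maps, so `Φ⁻¹` contracted is the inverse of `Φ` contracted. The
formula for `Δ(v)` then becomes the Yetter–Drinfeld condition by moving the two outer factors
across. -/
theorem isAdmissiblePair_iff (σ : H →ₐ[k] k) (v : H) :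
    IsAdmissiblePair Q σ v ↔ Q.IsYDPair σ v ∧ σ v = -1 := by
  have key : Q.comul v = contr₃ σ (↑Q.Φ⁻¹ : H ⊗[k] (H ⊗[k] H)) *
      ((1 ⊗ₜ[k] v) * contr₂ σ (Q.Φ : H ⊗[k] (H ⊗[k] H)) * (v ⊗ₜ[k] 1)) *
      contr₁ σ (↑Q.Φ⁻¹ : H ⊗[k] (H ⊗[k] H)) ↔
      (1 ⊗ₜ[k] v) * contr₂ σ (Q.Φ : H ⊗[k] (H ⊗[k] H)) * (v ⊗ₜ[k] 1) =
      contr₃ σ (Q.Φ : H ⊗[k] (H ⊗[k] H)) * Q.comul v *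
        contr₁ σ (Q.Φ : H ⊗[k] (H ⊗[k] H)) := by
    have h1 : ∀ f : H ⊗[k] (H ⊗[k] H) →ₐ[k] H ⊗[k] H,
        f ↑Q.Φ⁻¹ = ↑(Units.map (f : H ⊗[k] (H ⊗[k] H) →* H ⊗[k] H) Q.Φ)⁻¹ := fun f => rfl
    have h2 : ∀ f : H ⊗[k] (H ⊗[k] H) →ₐ[k] H ⊗[k] H,
        f ↑Q.Φ = ↑(Units.map (f : H ⊗[k] (H ⊗[k] H) →* H ⊗[k] H) Q.Φ) := fun f => rfl
    rw [h1, h1, h2 (contr₃ σ), h2 (contr₁ σ), Units.eq_mul_inv_iff_mul_eq,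
      Units.eq_inv_mul_iff_mul_eq, ← mul_assoc]
    exact eq_comm
  exact ⟨fun h => ⟨⟨h.counit_v, key.1 h.comul_v, h.comm_v⟩, h.map_v⟩,
    fun h => ⟨h.2, h.1.counit, key.2 h.1.comul, h.1.comm⟩⟩

end QuasiBialgebra

/-- A functional that does not vanish at `m` recovers the left factor up to a nonzero scalar. -/
theorem tmul_right_cancel {k A M : Type*} [Field k] [AddCommGroup A] [Module k A]
    [AddCommGroup M] [Module k M] {m : M} (hm : m ≠ 0) {x y : A}
    (h : x ⊗ₜ[k] m = y ⊗ₜ[k] m) : x = y := by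
  obtain ⟨f, hf⟩ : ∃ f : Module.Dual k M, f m ≠ 0 := by
    by_contra! hf
    exact hm ((Module.forall_dual_apply_eq_zero_iff k m).1 hf)
  have h' := congrArg (fun t => TensorProduct.rid k A (TensorProduct.map LinearMap.id f t)) h
  simp only [TensorProduct.map_tmul, LinearMap.id_apply, TensorProduct.rid_tmul] at h'
  exact smul_right_injective A hf h'

/-! ### One-dimensional Yetter–Drinfeld modules -/

namespace BraidedHopfData

variable {k H B : Type*} [Field k] [Ring H] [Algebra k H] [AddCommGroup B] [Module k B]

/-- `m` spans a subobject with action `h · m = χ(h) m` and coaction `m ↦ u ⊗ m`. -/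
structure IsEigenvector (D : BraidedHopfData k H B) (χ : H →ₐ[k] k) (u : H) (m : B) : Prop where
  act : ∀ h, D.act h m = χ h • m
  coact : D.coact m = u ⊗ₜ m

namespace IsEigenvector

variable {D : BraidedHopfData k H B} {χ : H →ₐ[k] k} {u : H} {m : B}

/-- On an eigenvector `m`, each side of a Yetter–Drinfeld axiom is an element of `H` or `H ⊗ H`
tensored with `m`. This computation and the three after it serve twice: cancelling `m` extracts the
conditions on `(χ, u)`, and substituting those conditions proves the axioms. -/
theorem coact_coassoc_left (hm : D.IsEigenvector χ u m) (Q : QuasiBialgebra k H) :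
    TensorProduct.map LinearMap.id (braid D.coact (Algebra.lmul k H))
        (assocΦ Q (Algebra.lmul k H) D.act (Algebra.lmul k H) (D.coact m ⊗ₜ[k] (1 : H))) =
      TensorProduct.assoc k H H B
        (((1 ⊗ₜ[k] u) * contr₂ χ (Q.Φ : H ⊗[k] (H ⊗[k] H)) * (u ⊗ₜ[k] 1)) ⊗ₜ m) := by
  have h2 : ∀ (x : H) (s : H ⊗[k] H), TensorProduct.map LinearMap.id
      (braid D.coact (Algebra.lmul k H))
      (x ⊗ₜ actTensor D.act (Algebra.lmul k H) s (m ⊗ₜ 1)) =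
      TensorProduct.assoc k H H B ((x ⊗ₜ[k] (u * contrFst χ s)) ⊗ₜ m) := by
    intro x s
    rw [actTensor_tmul_of_left hm.act, TensorProduct.map_tmul, braid_tmul_of_coact hm.coact]
    simp
    rfl
  have h1 : ∀ t : H ⊗[k] (H ⊗[k] H), TensorProduct.map LinearMap.id
      (braid D.coact (Algebra.lmul k H))
      (actTensor (Algebra.lmul k H) (actTensor D.act (Algebra.lmul k H)) t (u ⊗ₜ (m ⊗ₜ 1))) =
      TensorProduct.assoc k H H B (((1 ⊗ₜ[k] u) * contr₂ χ t * (u ⊗ₜ[k] 1)) ⊗ₜ m) := by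
    intro t
    induction t with
    | zero => simp
    | tmul x s =>
      rw [actTensor_tmul_tmul, h2]
      simp
    | add x y hx hy => simp only [map_add, LinearMap.add_apply, hx, hy, mul_add, add_mul,
        TensorProduct.add_tmul]
  rw [hm.coact, ← h1]
  simp [assocΦ]

theorem coact_coassoc_right (hm : D.IsEigenvector χ u m) (Q : QuasiBialgebra k H) :
    assocΦ Q (Algebra.lmul k H) (Algebra.lmul k H) D.act
        (braid D.coact (actDiag Q (Algebra.lmul k H) (Algebra.lmul k H))
          (assocΦ Q D.act (Algebra.lmul k H) (Algebra.lmul k H)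
            ((m ⊗ₜ[k] (1 : H)) ⊗ₜ[k] (1 : H)))) =
      TensorProduct.assoc k H H B
        ((contr₃ χ (Q.Φ : H ⊗[k] (H ⊗[k] H)) * Q.comul u *
          contr₁ χ (Q.Φ : H ⊗[k] (H ⊗[k] H))) ⊗ₜ m) := by
  have h2 : ∀ (x y : H) (s : H ⊗[k] H),
      x ⊗ₜ actTensor (Algebra.lmul k H) D.act s (y ⊗ₜ m) =
        TensorProduct.assoc k H H B ((x ⊗ₜ[k] (contrSnd χ s * y)) ⊗ₜ m) := by
    intro x y s
    rw [actTensor_tmul_of_right _ hm.act]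
    simp
    rfl
  have h1 : ∀ (t : H ⊗[k] (H ⊗[k] H)) (z : H ⊗[k] H),
      actTensor (Algebra.lmul k H) (actTensor (Algebra.lmul k H) D.act) t
        (TensorProduct.assoc k H H B (z ⊗ₜ m)) =
        TensorProduct.assoc k H H B ((contr₃ χ t * z) ⊗ₜ m) := by
    intro t z
    induction t with
    | zero => simp
    | tmul x s =>
      induction z with
      | zero => simp
      | tmul y w =>
        rw [TensorProduct.assoc_tmul, actTensor_tmul_tmul, h2]
        simp
      | add y z hy hz => simp only [map_add, hy, hz, mul_add, TensorProduct.add_tmul]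
    | add x y hx hy => simp only [map_add, LinearMap.add_apply, hx, hy, add_mul,
        TensorProduct.add_tmul]
  have h3 : assocΦ Q D.act (Algebra.lmul k H) (Algebra.lmul k H)
      ((m ⊗ₜ[k] (1 : H)) ⊗ₜ[k] (1 : H)) = m ⊗ₜ contr₁ χ (Q.Φ : H ⊗[k] (H ⊗[k] H)) := by
    rw [assocΦ, LinearMap.comp_apply, LinearEquiv.coe_coe, TensorProduct.assoc_tmul,
      actTensor_tmul_of_left hm.act, actTensor_lmul, ← Algebra.TensorProduct.one_def, mul_one]
    rfl
  rw [h3, braid_tmul_of_coact hm.coact, actDiag, AlgHom.comp_apply, actTensor_lmul, mul_assoc,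
    ← h1]
  simp [assocΦ]

theorem act_coact_left (hm : D.IsEigenvector χ u m) (Q : QuasiBialgebra k H) (h : H) :
    actDiag Q (Algebra.lmul k H) D.act h (D.coact m) = (contrSnd χ (Q.comul h) * u) ⊗ₜ m := by
  rw [hm.coact, actDiag, AlgHom.comp_apply, actTensor_tmul_of_right _ hm.act]
  rfl

theorem act_coact_right (hm : D.IsEigenvector χ u m) (Q : QuasiBialgebra k H) (h : H) :
    braid D.coact (Algebra.lmul k H) (actDiag Q D.act (Algebra.lmul k H) h (m ⊗ₜ[k] (1 : H))) =
      (u * contrFst χ (Q.comul h)) ⊗ₜ m := by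
  rw [actDiag, AlgHom.comp_apply, actTensor_tmul_of_left hm.act, braid_tmul_of_coact hm.coact]
  simp
  rfl

theorem isYDPair (hm : D.IsEigenvector χ u m) (hm0 : m ≠ 0) {Q : QuasiBialgebra k H}
    (hD : D.IsYDModule Q) : Q.IsYDPair χ u where
  counit := by
    have h := hD.counit_coact m
    rw [hm.coact] at h
    simp only [TensorProduct.map_tmul, TensorProduct.lid_tmul, LinearMap.id_apply,
      AlgHom.toLinearMap_apply] at h
    exact smul_left_injective k hm0 (h.trans (one_smul k m).symm)
  comul := by
    have h := hD.coact_coassoc m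
    rw [hm.coact_coassoc_left, hm.coact_coassoc_right] at h
    exact tmul_right_cancel hm0 ((TensorProduct.assoc k H H B).injective h)
  comm h := by
    have h := hD.act_coact h m
    rw [hm.act_coact_left, hm.act_coact_right] at h
    exact tmul_right_cancel hm0 h

end IsEigenvector

/-- Each axiom is linear in `m`, so it is rewritten as an equality of linear maps and tested on the
basis. The later verifications use the same device. -/
theorem isYDModule_of_basis {ι : Type*} (b : Module.Basis ι k B) (D : BraidedHopfData k H B)
    (Q : QuasiBialgebra k H) {χ : ι → H →ₐ[k] k} {u : ι → H}
    (hb : ∀ i, D.IsEigenvector (χ i) (u i) (b i)) (hχ : ∀ i, Q.IsYDPair (χ i) (u i)) :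
    D.IsYDModule Q where
  counit_coact m := by
    refine DFunLike.congr_fun (f := (TensorProduct.lid k B).toLinearMap ∘ₗ
      TensorProduct.map Q.counit.toLinearMap LinearMap.id ∘ₗ D.coact) (g := LinearMap.id)
      (b.ext fun i => ?_) m
    simp [(hb i).coact, (hχ i).counit]
  coact_coassoc m := by
    refine DFunLike.congr_fun
      (f := TensorProduct.map LinearMap.id (braid D.coact (Algebra.lmul k H)) ∘ₗ
        assocΦ Q (Algebra.lmul k H) D.act (Algebra.lmul k H) ∘ₗ
        (TensorProduct.mk k _ H).flip 1 ∘ₗ D.coact)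
      (g := assocΦ Q (Algebra.lmul k H) (Algebra.lmul k H) D.act ∘ₗ
        braid D.coact (actDiag Q (Algebra.lmul k H) (Algebra.lmul k H)) ∘ₗ
        assocΦ Q D.act (Algebra.lmul k H) (Algebra.lmul k H) ∘ₗ
        (TensorProduct.mk k _ H).flip 1 ∘ₗ (TensorProduct.mk k _ H).flip 1)
      (b.ext fun i => ?_) m
    exact ((hb i).coact_coassoc_left Q).trans
      (.trans (by rw [(hχ i).comul]) ((hb i).coact_coassoc_right Q).symm)
  act_coact h m := by
    refine DFunLike.congr_fun
      (f := actDiag Q (Algebra.lmul k H) D.act h ∘ₗ D.coact)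
      (g := braid D.coact (Algebra.lmul k H) ∘ₗ actDiag Q D.act (Algebra.lmul k H) h ∘ₗ
        (TensorProduct.mk k _ H).flip 1)
      (b.ext fun i => ?_) m
    exact ((hb i).act_coact_left Q h).trans
      (.trans (by rw [(hχ i).comm]) ((hb i).act_coact_right Q h).symm)

end BraidedHopfData

/-! ### Two-dimensional braided Hopf algebras in normal form -/

namespace BraidedHopfData

variable {k H B C : Type*} [Field k] [Ring H] [Algebra k H] [AddCommGroup B] [Module k B]
  [AddCommGroup C] [Module k C]

/-- The data `D` are given on the basis `b 0, b 1` by: `b 0` is the unit, with trivial action and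
coaction; `h · b 1 = σ(h) b 1`, `b 1 ↦ v ⊗ b 1`, `(b 1)² = c b 1`,
`Δ(b 1) = b 1 ⊗ 1 + 1 ⊗ b 1 + μ b 1 ⊗ b 1`, `ε(b 1) = 0` and `S(b 1) = s b 1`. -/
structure HasTwoDimShape (Q : QuasiBialgebra k H) (D : BraidedHopfData k H B)
    (b : Module.Basis (Fin 2) k B) (σ : H →ₐ[k] k) (v : H) (c μ s : k) : Prop where
  one_eq : D.one = b 0
  eigen_zero : D.IsEigenvector Q.counit 1 (b 0)
  eigen_one : D.IsEigenvector σ v (b 1)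
  mul_zero_zero : D.mul (b 0 ⊗ₜ b 0) = b 0
  mul_zero_one : D.mul (b 0 ⊗ₜ b 1) = b 1
  mul_one_zero : D.mul (b 1 ⊗ₜ b 0) = b 1
  mul_one_one : D.mul (b 1 ⊗ₜ b 1) = c • b 1
  comul_zero : D.comul (b 0) = b 0 ⊗ₜ b 0
  comul_one : D.comul (b 1) = b 1 ⊗ₜ b 0 + b 0 ⊗ₜ b 1 + μ • (b 1 ⊗ₜ b 1)
  counit_zero : D.counit (b 0) = 1
  counit_one : D.counit (b 1) = 0
  antipode_zero : D.antipode (b 0) = b 0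
  antipode_one : D.antipode (b 1) = s • b 1

namespace HasTwoDimShape

variable {Q : QuasiBialgebra k H} {D : BraidedHopfData k H B} {E : BraidedHopfData k H C}
  {b : Module.Basis (Fin 2) k B} {b' : Module.Basis (Fin 2) k C} {σ : H →ₐ[k] k} {v : H}
  {c μ s : k}

/-- The parameters determine every structure map on the basis, so matching the two bases is an
isomorphism. -/
theorem isomorphic (hD : D.HasTwoDimShape Q b σ v c μ s) (hE : E.HasTwoDimShape Q b' σ v c μ s) :
    D.Isomorphic E := by
  obtain ⟨f, h0, h1⟩ : ∃ f : B ≃ₗ[k] C, f (b 0) = b' 0 ∧ f (b 1) = b' 1 :=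
    ⟨b.equiv b' (Equiv.refl _), by simp, by simp⟩
  refine ⟨f, fun h x => ?_, fun x => ?_, fun x y => ?_, ?_, fun x => ?_, fun x => ?_, fun x => ?_⟩
  · refine DFunLike.congr_fun (f := f.toLinearMap ∘ₗ D.act h) (g := E.act h ∘ₗ f.toLinearMap)
      (b.ext fun i => ?_) x
    fin_cases i <;>
      simp [hD.eigen_zero.act, hD.eigen_one.act, hE.eigen_zero.act, hE.eigen_one.act, h0, h1]
  · refine DFunLike.congr_fun (f := E.coact ∘ₗ f.toLinearMap)
      (g := TensorProduct.map LinearMap.id f.toLinearMap ∘ₗ D.coact) (b.ext fun i => ?_) x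
    fin_cases i <;>
      simp [hD.eigen_zero.coact, hD.eigen_one.coact, hE.eigen_zero.coact, hE.eigen_one.coact,
        h0, h1]
  · refine DFunLike.congr_fun (f := f.toLinearMap ∘ₗ D.mul)
      (g := E.mul ∘ₗ TensorProduct.map f.toLinearMap f.toLinearMap)
      ((b.tensorProduct b).ext fun i => ?_) (x ⊗ₜ y)
    obtain ⟨i, j⟩ := i
    fin_cases i <;> fin_cases j <;>
      simp [h0, h1, hD.mul_zero_zero, hD.mul_zero_one, hD.mul_one_zero, hD.mul_one_one,
        hE.mul_zero_zero, hE.mul_zero_one, hE.mul_one_zero, hE.mul_one_one]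
  · rw [hD.one_eq, h0, hE.one_eq]
  · refine DFunLike.congr_fun (f := E.comul ∘ₗ f.toLinearMap)
      (g := TensorProduct.map f.toLinearMap f.toLinearMap ∘ₗ D.comul) (b.ext fun i => ?_) x
    fin_cases i <;> simp [h0, h1, hD.comul_zero, hD.comul_one, hE.comul_zero, hE.comul_one]
  · refine DFunLike.congr_fun (f := E.counit ∘ₗ f.toLinearMap)
      (g := D.counit) (b.ext fun i => ?_) x
    fin_cases i <;> simp [h0, h1, hD.counit_zero, hD.counit_one, hE.counit_zero, hE.counit_one]
  · refine DFunLike.congr_fun (f := f.toLinearMap ∘ₗ D.antipode)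
      (g := E.antipode ∘ₗ f.toLinearMap) (b.ext fun i => ?_) x
    fin_cases i <;>
      simp [h0, h1, hD.antipode_zero, hD.antipode_one, hE.antipode_zero, hE.antipode_one]

theorem isYDModule (hD : D.HasTwoDimShape Q b σ v c μ s) (hv : Q.IsYDPair σ v) :
    D.IsYDModule Q :=
  isYDModule_of_basis b D Q (χ := ![Q.counit, σ]) (u := ![1, v])
    (fun i => by fin_cases i; exacts [hD.eigen_zero, hD.eigen_one])
    (fun i => by fin_cases i; exacts [Q.isYDPair_counit, hv])

/-- With `n² = 0`, any tensor with two or more factors `n` multiplies to zero, so unknown scalars of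
`Φ` or of `σ * σ` are harmless; on all other tensors they are trivial by normalisation. -/
theorem isYDAlgebra (hD : D.HasTwoDimShape Q b σ v 0 μ s) (hv : Q.IsYDPair σ v) :
    D.IsYDAlgebra Q where
  __ := hD.isYDModule hv
  one_mul x := by
    refine DFunLike.congr_fun (f := D.mul ∘ₗ TensorProduct.mk k B B D.one) (g := LinearMap.id)
      (b.ext fun i => ?_) x
    fin_cases i <;> simp [hD.one_eq, hD.mul_zero_zero, hD.mul_zero_one]
  mul_one x := by
    refine DFunLike.congr_fun (f := D.mul ∘ₗ (TensorProduct.mk k B B).flip D.one)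
      (g := LinearMap.id) (b.ext fun i => ?_) x
    fin_cases i <;> simp [hD.one_eq, hD.mul_zero_zero, hD.mul_one_zero]
  act_mul h t := by
    refine DFunLike.congr_fun (f := D.act h ∘ₗ D.mul) (g := D.mul ∘ₗ actDiag Q D.act D.act h)
      ((b.tensorProduct b).ext fun i => ?_) t
    have h0 := hD.eigen_zero.act
    have h1 := hD.eigen_one.act
    obtain ⟨i, j⟩ := i
    fin_cases i <;> fin_cases j <;>
      simp [hD.mul_zero_zero, hD.mul_zero_one, hD.mul_one_zero, hD.mul_one_one, h0, h1,
        actDiag_of_eigen Q h0 h0, actDiag_of_eigen Q h0 h1, actDiag_of_eigen Q h1 h0,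
        actDiag_of_eigen Q h1 h1]
  act_one h := by rw [hD.one_eq, hD.eigen_zero.act]
  mul_assoc t := by
    refine DFunLike.congr_fun (f := D.mul ∘ₗ TensorProduct.map D.mul LinearMap.id)
      (g := D.mul ∘ₗ TensorProduct.map LinearMap.id D.mul ∘ₗ assocΦ Q D.act D.act D.act)
      (((b.tensorProduct b).tensorProduct b).ext fun i => ?_) t
    have h0 := hD.eigen_zero.act
    have h1 := hD.eigen_one.act
    obtain ⟨⟨i, j⟩, l⟩ := i
    fin_cases i <;> fin_cases j <;> fin_cases l <;>
      simp [hD.mul_zero_zero, hD.mul_zero_one, hD.mul_one_zero, hD.mul_one_one,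
        assocΦ_of_eigen Q h0 h0 h0, assocΦ_of_eigen Q h0 h0 h1, assocΦ_of_eigen Q h0 h1 h0,
        assocΦ_of_eigen Q h0 h1 h1, assocΦ_of_eigen Q h1 h0 h0, assocΦ_of_eigen Q h1 h0 h1,
        assocΦ_of_eigen Q h1 h1 h0, assocΦ_of_eigen Q h1 h1 h1]
  coact_mul t := by
    refine DFunLike.congr_fun (f := D.coact ∘ₗ D.mul)
      (g := TensorProduct.map LinearMap.id D.mul ∘ₗ coactTensor Q D.act D.coact D.act D.coact)
      ((b.tensorProduct b).ext fun i => ?_) t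
    have h0 := hD.eigen_zero.act
    have h1 := hD.eigen_one.act
    have u0 := hD.eigen_zero.coact
    have u1 := hD.eigen_one.coact
    obtain ⟨i, j⟩ := i
    fin_cases i <;> fin_cases j <;>
      simp [hD.mul_zero_zero, hD.mul_zero_one, hD.mul_one_zero, hD.mul_one_one, u0, u1,
        coactTensor_of_eigen_left Q h0 h0 u0 u0, coactTensor_of_eigen_left Q h0 h1 u0 u1,
        coactTensor_of_eigen_right Q h1 h0 u1 u0, coactTensor_of_eigen Q h1 h1 u1 u1]
  coact_one := by rw [hD.one_eq, hD.eigen_zero.coact]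

/-- With `μ = 0`, every tensor that occurs has at most one factor `n`, so all reassociator scalars
are `1`. -/
theorem isYDCoalgebra (hD : D.HasTwoDimShape Q b σ v c 0 s) (hv : Q.IsYDPair σ v) :
    D.IsYDCoalgebra Q where
  __ := hD.isYDModule hv
  counit_fst x := by
    refine DFunLike.congr_fun (f := (TensorProduct.lid k B).toLinearMap ∘ₗ
      TensorProduct.map D.counit LinearMap.id ∘ₗ D.comul) (g := LinearMap.id)
      (b.ext fun i => ?_) x
    fin_cases i <;> simp [hD.comul_zero, hD.comul_one, hD.counit_zero, hD.counit_one]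
  counit_snd x := by
    refine DFunLike.congr_fun (f := (TensorProduct.rid k B).toLinearMap ∘ₗ
      TensorProduct.map LinearMap.id D.counit ∘ₗ D.comul) (g := LinearMap.id)
      (b.ext fun i => ?_) x
    fin_cases i <;> simp [hD.comul_zero, hD.comul_one, hD.counit_zero, hD.counit_one]
  act_comul h x := by
    refine DFunLike.congr_fun (f := D.comul ∘ₗ D.act h) (g := actDiag Q D.act D.act h ∘ₗ D.comul)
      (b.ext fun i => ?_) x
    have h0 := hD.eigen_zero.act
    have h1 := hD.eigen_one.act
    fin_cases i <;>
      simp [hD.comul_zero, hD.comul_one, h0, h1, actDiag_of_eigen Q h0 h0,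
        actDiag_of_eigen Q h0 h1, actDiag_of_eigen Q h1 h0]
  act_counit h x := by
    refine DFunLike.congr_fun (f := D.counit ∘ₗ D.act h) (g := Q.counit h • D.counit)
      (b.ext fun i => ?_) x
    fin_cases i <;> simp [hD.counit_zero, hD.counit_one, hD.eigen_zero.act, hD.eigen_one.act]
  coassoc x := by
    refine DFunLike.congr_fun (f := assocΦ Q D.act D.act D.act ∘ₗ
      TensorProduct.map D.comul LinearMap.id ∘ₗ D.comul)
      (g := TensorProduct.map LinearMap.id D.comul ∘ₗ D.comul) (b.ext fun i => ?_) x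
    have h0 := hD.eigen_zero.act
    have h1 := hD.eigen_one.act
    fin_cases i <;>
      simp [hD.comul_zero, hD.comul_one, TensorProduct.add_tmul, TensorProduct.tmul_add, add_assoc,
        assocΦ_of_eigen Q h0 h0 h0, assocΦ_of_eigen Q h0 h0 h1, assocΦ_of_eigen Q h0 h1 h0,
        assocΦ_of_eigen Q h1 h0 h0]
  coact_comul x := by
    refine DFunLike.congr_fun (f := TensorProduct.map LinearMap.id D.comul ∘ₗ D.coact)
      (g := coactTensor Q D.act D.coact D.act D.coact ∘ₗ D.comul) (b.ext fun i => ?_) x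
    have h0 := hD.eigen_zero.act
    have h1 := hD.eigen_one.act
    have u0 := hD.eigen_zero.coact
    have u1 := hD.eigen_one.coact
    fin_cases i <;>
      simp [hD.comul_zero, hD.comul_one, u0, u1, TensorProduct.tmul_add,
        coactTensor_of_eigen_left Q h0 h0 u0 u0, coactTensor_of_eigen_left Q h0 h1 u0 u1,
        coactTensor_of_eigen_right Q h1 h0 u1 u0]
  coact_counit x := by
    refine DFunLike.congr_fun (f := (TensorProduct.rid k H).toLinearMap ∘ₗ
      TensorProduct.map LinearMap.id D.counit ∘ₗ D.coact)
      (g := D.counit.smulRight (1 : H)) (b.ext fun i => ?_) x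
    fin_cases i <;> simp [hD.counit_zero, hD.counit_one, hD.eigen_zero.coact, hD.eigen_one.coact]

theorem isYDBialgebra (hD : D.HasTwoDimShape Q b σ v 0 0 s) (hv : Q.IsYDPair σ v)
    (hσ : σ v = -1) : D.IsYDBialgebra Q where
  __ := hD.isYDAlgebra hv
  __ := hD.isYDCoalgebra hv
  comul_one := by rw [hD.one_eq, hD.comul_zero]
  counit_one := by rw [hD.one_eq, hD.counit_zero]
  counit_mul x y := by
    refine DFunLike.congr_fun (f := D.counit ∘ₗ D.mul)
      (g := (TensorProduct.lid k k).toLinearMap ∘ₗ TensorProduct.map D.counit D.counit)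
      ((b.tensorProduct b).ext fun i => ?_) (x ⊗ₜ y)
    obtain ⟨i, j⟩ := i
    fin_cases i <;> fin_cases j <;>
      simp [hD.mul_zero_zero, hD.mul_zero_one, hD.mul_one_zero, hD.mul_one_one, hD.counit_zero,
        hD.counit_one]
  comul_mul x y := by
    refine DFunLike.congr_fun (f := D.comul ∘ₗ D.mul)
      (g := mulTensor Q D.act D.coact D.mul ∘ₗ TensorProduct.map D.comul D.comul)
      ((b.tensorProduct b).ext fun i => ?_) (x ⊗ₜ y)
    have h0 := hD.eigen_zero.act
    have h1 := hD.eigen_one.act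
    have u0 := hD.eigen_zero.coact
    have u1 := hD.eigen_one.coact
    -- The only case where the braiding matters is `n, n`: the product `Δ(n)Δ(n)` is `(1 + σ(v)) n ⊗
    -- n`, which vanishes since `σ(v) = -1`.
    obtain ⟨i, j⟩ := i
    fin_cases i <;> fin_cases j <;>
      simp [hD.mul_zero_zero, hD.mul_zero_one, hD.mul_one_zero, hD.mul_one_one, hD.comul_zero,
        hD.comul_one, TensorProduct.add_tmul, TensorProduct.tmul_add, mulTensorScalar, hσ, hv.counit,
        mulTensor_of_eigen Q D.mul h0 h0 h0 h0 u0, mulTensor_of_eigen Q D.mul h0 h0 h0 h1 u0,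
        mulTensor_of_eigen Q D.mul h0 h0 h1 h0 u0, mulTensor_of_eigen Q D.mul h0 h1 h0 h0 u1,
        mulTensor_of_eigen Q D.mul h1 h0 h0 h0 u0, mulTensor_of_eigen Q D.mul h0 h1 h0 h1 u1,
        mulTensor_of_eigen Q D.mul h0 h1 h1 h0 u1, mulTensor_of_eigen Q D.mul h1 h0 h0 h1 u0,
        mulTensor_of_eigen Q D.mul h1 h0 h1 h0 u0]

theorem isYDHopfAlgebra (hD : D.HasTwoDimShape Q b σ v 0 0 (-1)) (hv : Q.IsYDPair σ v)
    (hσ : σ v = -1) : D.IsYDHopfAlgebra Q where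
  __ := hD.isYDBialgebra hv hσ
  act_antipode h x := by
    refine DFunLike.congr_fun (f := D.antipode ∘ₗ D.act h) (g := D.act h ∘ₗ D.antipode)
      (b.ext fun i => ?_) x
    fin_cases i <;>
      simp [hD.antipode_zero, hD.antipode_one, hD.eigen_zero.act, hD.eigen_one.act]
  coact_antipode x := by
    refine DFunLike.congr_fun (f := D.coact ∘ₗ D.antipode)
      (g := TensorProduct.map LinearMap.id D.antipode ∘ₗ D.coact) (b.ext fun i => ?_) x
    fin_cases i <;>
      simp [hD.antipode_zero, hD.antipode_one, hD.eigen_zero.coact, hD.eigen_one.coact,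
        TensorProduct.tmul_neg]
  antipode_fst x := by
    refine DFunLike.congr_fun (f := D.mul ∘ₗ TensorProduct.map D.antipode LinearMap.id ∘ₗ D.comul)
      (g := D.counit.smulRight D.one) (b.ext fun i => ?_) x
    fin_cases i <;>
      simp [hD.antipode_zero, hD.antipode_one, hD.comul_zero, hD.comul_one, hD.one_eq,
        hD.counit_zero, hD.counit_one, hD.mul_zero_zero, hD.mul_zero_one, hD.mul_one_zero,
        TensorProduct.neg_tmul]
  antipode_snd x := by
    refine DFunLike.congr_fun (f := D.mul ∘ₗ TensorProduct.map LinearMap.id D.antipode ∘ₗ D.comul)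
      (g := D.counit.smulRight D.one) (b.ext fun i => ?_) x
    fin_cases i <;>
      simp [hD.antipode_zero, hD.antipode_one, hD.comul_zero, hD.comul_one, hD.one_eq,
        hD.counit_zero, hD.counit_one, hD.mul_zero_zero, hD.mul_zero_one, hD.mul_one_zero,
        TensorProduct.tmul_neg]

end HasTwoDimShape

end BraidedHopfData

/-! ### The group algebra `k[C₂]` with trivial action and coaction -/

namespace BraidedHopfData

variable {k H : Type*} [Field k] [Ring H] [Algebra k H]

section Trivial

variable (Q : QuasiBialgebra k H)

theorem isEigenvector_trivialC₂ (m : MonoidAlgebra k (Multiplicative (ZMod 2))) :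
    (trivialC₂ Q).IsEigenvector Q.counit 1 m where
  act h := by simp [trivialC₂, Algebra.ofId_apply, Algebra.algebraMap_eq_smul_one]
  coact := by simp [trivialC₂]

/-- Every vector is an eigenvector for the counit with coaction `1`. Hence the associativity
constraint, the tensor coaction and the braided product on `B ⊗ B` all reduce to the ordinary ones,
as recorded here and in the next lemmas. -/
theorem actDiag_trivialC₂ (h : H) : actDiag Q (trivialC₂ Q).act (trivialC₂ Q).act h =
    Q.counit h • LinearMap.id := by
  refine TensorProduct.ext' fun x y => ?_
  rw [actDiag_of_eigen Q (isEigenvector_trivialC₂ Q x).act (isEigenvector_trivialC₂ Q y).act]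
  simp

theorem assocΦ_trivialC₂ : assocΦ Q (trivialC₂ Q).act (trivialC₂ Q).act (trivialC₂ Q).act =
    (TensorProduct.assoc k _ _ _).toLinearMap := by
  refine TensorProduct.ext_threefold fun x y z => ?_
  rw [assocΦ_of_eigen Q (isEigenvector_trivialC₂ Q x).act (isEigenvector_trivialC₂ Q y).act
    (isEigenvector_trivialC₂ Q z).act]
  simp

theorem coactTensor_trivialC₂ : coactTensor Q (trivialC₂ Q).act (trivialC₂ Q).coact
    (trivialC₂ Q).act (trivialC₂ Q).coact = TensorProduct.mk k H _ 1 := by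
  refine TensorProduct.ext' fun x y => ?_
  rw [coactTensor_of_eigen_left Q (isEigenvector_trivialC₂ Q x).act
    (isEigenvector_trivialC₂ Q y).act (isEigenvector_trivialC₂ Q x).coact
    (isEigenvector_trivialC₂ Q y).coact]
  simp

theorem mulTensor_trivialC₂ : mulTensor Q (trivialC₂ Q).act (trivialC₂ Q).coact
    (trivialC₂ Q).mul = LinearMap.mul' k _ := by
  refine TensorProduct.ext_fourfold' fun x y z w => ?_
  rw [mulTensor_of_eigen Q _ (isEigenvector_trivialC₂ Q x).act (isEigenvector_trivialC₂ Q y).act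
    (isEigenvector_trivialC₂ Q z).act (isEigenvector_trivialC₂ Q w).act
    (isEigenvector_trivialC₂ Q y).coact]
  simp [mulTensorScalar, trivialC₂]

theorem isYDModule_trivialC₂ : (trivialC₂ Q).IsYDModule Q :=
  isYDModule_of_basis (Module.Basis.ofVectorSpace k _) _ Q
    (fun _ => isEigenvector_trivialC₂ Q _) (fun _ => Q.isYDPair_counit)

theorem isYDAlgebra_trivialC₂ : (trivialC₂ Q).IsYDAlgebra Q where
  __ := isYDModule_trivialC₂ Q
  one_mul x := by simp [trivialC₂]
  mul_one x := by simp [trivialC₂]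
  act_mul h t := by rw [actDiag_trivialC₂, (isEigenvector_trivialC₂ Q _).act]; simp
  act_one h := (isEigenvector_trivialC₂ Q _).act h
  mul_assoc t := by
    rw [assocΦ_trivialC₂]
    refine DFunLike.congr_fun (f := (trivialC₂ Q).mul ∘ₗ
        TensorProduct.map (trivialC₂ Q).mul LinearMap.id)
      (g := (trivialC₂ Q).mul ∘ₗ TensorProduct.map LinearMap.id (trivialC₂ Q).mul ∘ₗ
        (TensorProduct.assoc k _ _ _).toLinearMap)
      (TensorProduct.ext_threefold fun x y z => ?_) t
    simp [trivialC₂, mul_assoc]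
  coact_mul t := by
    rw [coactTensor_trivialC₂, (isEigenvector_trivialC₂ Q _).coact]; simp
  coact_one := (isEigenvector_trivialC₂ Q _).coact

theorem isYDCoalgebra_trivialC₂ : (trivialC₂ Q).IsYDCoalgebra Q where
  __ := isYDModule_trivialC₂ Q
  counit_fst x := by
    simpa [trivialC₂, LinearMap.rTensor] using
      congrArg (TensorProduct.lid k _) (Coalgebra.rTensor_counit_comul (R := k) x)
  counit_snd x := by
    simpa [trivialC₂, LinearMap.lTensor] using
      congrArg (TensorProduct.rid k _) (Coalgebra.lTensor_counit_comul (R := k) x)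
  act_comul h x := by rw [actDiag_trivialC₂, (isEigenvector_trivialC₂ Q _).act]; simp
  act_counit h x := by rw [(isEigenvector_trivialC₂ Q _).act]; simp
  coassoc x := by
    rw [assocΦ_trivialC₂]
    exact Coalgebra.coassoc_apply x
  coact_comul x := by
    rw [coactTensor_trivialC₂, (isEigenvector_trivialC₂ Q _).coact]; simp
  coact_counit x := by rw [(isEigenvector_trivialC₂ Q _).coact]; simp

theorem isYDHopfAlgebra_trivialC₂ : (trivialC₂ Q).IsYDHopfAlgebra Q where
  __ := isYDAlgebra_trivialC₂ Q
  __ := isYDCoalgebra_trivialC₂ Q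
  comul_one := Bialgebra.comul_one
  counit_one := Bialgebra.counit_one
  counit_mul := Bialgebra.counit_mul
  comul_mul x y := by
    rw [mulTensor_trivialC₂]
    exact Bialgebra.comul_mul x y
  act_antipode h x := by
    rw [(isEigenvector_trivialC₂ Q _).act, (isEigenvector_trivialC₂ Q _).act, map_smul]
  coact_antipode x := by
    rw [(isEigenvector_trivialC₂ Q _).coact, (isEigenvector_trivialC₂ Q _).coact]; simp
  antipode_fst x :=
    (HopfAlgebra.mul_antipode_rTensor_comul_apply (R := k) x).trans
      (Algebra.algebraMap_eq_smul_one _)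
  antipode_snd x :=
    (HopfAlgebra.mul_antipode_lTensor_comul_apply (R := k) x).trans
      (Algebra.algebraMap_eq_smul_one _)

end Trivial

end BraidedHopfData

/-- The basis `1, n` of the dual numbers. -/
def dualBasis (k : Type*) [Field k] : Module.Basis (Fin 2) k (DualNumber k) :=
  Module.Basis.ofEquivFun
    { toFun := fun x => ![x.fst, x.snd]
      map_add' := fun x y => by ext i; fin_cases i <;> simp
      map_smul' := fun a x => by ext i; fin_cases i <;> simp
      invFun := fun f => f 0 • 1 + f 1 • DualNumber.eps
      left_inv := fun x => by ext <;> simp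
      right_inv := fun f => by ext i; fin_cases i <;> simp }

theorem dualBasis_zero (k : Type*) [Field k] : dualBasis k 0 = 1 := by
  ext <;> simp [dualBasis]

theorem dualBasis_one (k : Type*) [Field k] : dualBasis k 1 = DualNumber.eps := by
  ext <;> simp [dualBasis]

/-! ### The two models in normal form -/

namespace BraidedHopfData

variable {k H : Type*} [Field k] [Ring H] [Algebra k H] (Q : QuasiBialgebra k H)

theorem hasTwoDimShape_braidedB (σ : H →ₐ[k] k) (v : H) :
    (braidedB Q σ v).HasTwoDimShape Q (dualBasis k) σ v 0 0 (-1) := by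
  constructor <;> (try constructor) <;> (try intro h) <;>
    simp [dualBasis_zero, dualBasis_one, braidedB, dualLift_apply, dualAct]

/-- Take `n = (c/2)(1 - g)`. From `(1 - g)² = 2(1 - g)` follows `n² = c n`, and `1 ⊗ 1 - g ⊗ g = m ⊗
1 + 1 ⊗ m - m ⊗ m` with `m = 1 - g` gives `μ = -2/c`. Keeping `c` arbitrary avoids rescaling the
algebra to be classified. -/
theorem exists_hasTwoDimShape_trivialC₂ (h2 : (2 : k) ≠ 0) {c : k} (hc : c ≠ 0) :
    ∃ b, (trivialC₂ Q).HasTwoDimShape Q b Q.counit 1 c (-2 / c) 1 := by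
  set g : MonoidAlgebra k (Multiplicative (ZMod 2)) :=
    MonoidAlgebra.single (Multiplicative.ofAdd 1) 1 with hg
  have hgg : g * g = 1 := by
    rw [hg, MonoidAlgebra.single_mul_single, MonoidAlgebra.one_def, mul_one]
    rfl
  have hΔ : Coalgebra.comul (R := k) g = g ⊗ₜ g := by simp [hg]
  have hε : Coalgebra.counit (R := k) g = 1 := by simp [hg]
  have hS : HopfAlgebra.antipode k g = g := by
    rw [hg, MonoidAlgebra.antipode_single]
    simp
    rfl
  have hfin : Fintype.card (Fin 2) =
      Module.finrank k (MonoidAlgebra k (Multiplicative (ZMod 2))) := by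
    rw [Module.finrank_eq_card_basis (MonoidAlgebra.basis (Multiplicative (ZMod 2)) k)]
    rfl
  have hli : LinearIndependent k ![1, (c / 2) • (1 - g)] := by
    rw [LinearIndependent.pair_iff]
    intro x y hxy
    have h1 := congrArg (fun t => MonoidAlgebra.coeff t 1) hxy
    have hg1 := congrArg (fun t => MonoidAlgebra.coeff t (Multiplicative.ofAdd 1)) hxy
    simp [hg, MonoidAlgebra.one_def] at h1 hg1
    -- The coefficient of `g` is `-yc/2`, so both `c ≠ 0` and `2 ≠ 0` are needed.
    have hy : y = 0 := hg1.resolve_right (not_or.2 ⟨hc, h2⟩)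
    simpa [hy] using h1
  clear_value g
  obtain ⟨b, hb0, hb1⟩ : ∃ b : Module.Basis (Fin 2) k (MonoidAlgebra k (Multiplicative (ZMod 2))),
      b 0 = 1 ∧ b 1 = (c / 2) • (1 - g) :=
    ⟨basisOfLinearIndependentOfCardEqFinrank hli hfin, by simp, by simp⟩
  refine ⟨b, hb0.symm, isEigenvector_trivialC₂ Q _, isEigenvector_trivialC₂ Q _, ?_, ?_, ?_, ?_,
    ?_, ?_, ?_, ?_, ?_, ?_⟩
  · simp [trivialC₂, hb0]
  · simp [trivialC₂, hb0]
  · simp [trivialC₂, hb0]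
  · simp only [trivialC₂, hb1, LinearMap.mul'_apply, smul_mul_smul_comm, mul_sub, sub_mul, one_mul,
      mul_one, hgg]
    match_scalars <;> field_simp <;> ring
  · simp [trivialC₂, hb0, Algebra.TensorProduct.one_def]
  · simp only [trivialC₂, hb0, hb1, map_smul, map_sub, hΔ, Bialgebra.comul_one,
      Algebra.TensorProduct.one_def, TensorProduct.smul_tmul, TensorProduct.tmul_smul,
      TensorProduct.sub_tmul, TensorProduct.tmul_sub]
    match_scalars <;> field_simp <;> ring
  · simp [trivialC₂, hb0]
  · simp [trivialC₂, hb1, hε]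
  · simp [trivialC₂, hb0]
  · simp [trivialC₂, hb1, hS]

end BraidedHopfData

/-! ### Consequences of the existence of an antipode of `H` -/

namespace QuasiHopfAlgebra

variable {k H : Type*} [Field k] [Ring H] [Algebra k H] (Q : QuasiHopfAlgebra k H)

/-- The character `χ ∘ S`. -/
def charAntipode (χ : H →ₐ[k] k) : H →ₐ[k] k :=
  AlgHom.ofLinearMap (χ.toLinearMap ∘ₗ Q.S) (by simp [Q.S_one])
    (fun x y => by simp [Q.S_mul, mul_comm])

@[simp] theorem charAntipode_apply (χ : H →ₐ[k] k) (h : H) : Q.charAntipode χ h = χ (Q.S h) := rfl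

/-- Applying `χ` to `X¹ β S(X²) α X³ = 1` puts a factor `χ(α)` in every term on the left. -/
theorem map_alpha_ne_zero (χ : H →ₐ[k] k) : χ Q.α ≠ 0 := by
  intro h0
  have key : ∀ t : H ⊗[k] (H ⊗[k] H), χ (LinearMap.mul' k H
      (TensorProduct.map (LinearMap.mulRight k Q.β)
        (LinearMap.mul' k H ∘ₗ TensorProduct.map (LinearMap.mulRight k Q.α ∘ₗ Q.S) LinearMap.id)
        t)) = 0 := by
    intro t
    induction t with
    | zero => simp
    | tmul x s =>
      induction s with
      | zero => simp
      | tmul y z => simp [h0]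
      | add y z hy hz => rw [TensorProduct.tmul_add, map_add, map_add, map_add, hy, hz, add_zero]
    | add x y hx hy => rw [map_add, map_add, map_add, hx, hy, add_zero]
  have h1 := key (Q.Φ : H ⊗[k] (H ⊗[k] H))
  rw [Q.Φ_antipode, map_one] at h1
  exact one_ne_zero h1

/-- Apply `χ` to `S(h₁) α h₂ = ε(h) α` and cancel the nonzero scalar `χ(α)`. -/
theorem conv_charAntipode (χ : H →ₐ[k] k) : Q.conv (Q.charAntipode χ) χ = Q.counit := by
  ext h
  have key : ∀ t : H ⊗[k] H, χ (LinearMap.mul' k H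
      (TensorProduct.map (LinearMap.mulRight k Q.α ∘ₗ Q.S) LinearMap.id t)) =
      tensorChar (Q.charAntipode χ) χ t * χ Q.α := by
    intro t
    induction t with
    | zero => simp
    | tmul x y => simp [mul_right_comm]
    | add x y hx hy => rw [map_add, map_add, map_add, hx, hy, map_add, add_mul]
  have h1 := key (Q.comul h)
  rw [Q.S_alpha, map_smul, smul_eq_mul] at h1
  exact (mul_right_cancel₀ (Q.map_alpha_ne_zero χ) h1).symm

/-- An idempotent character is the counit. -/
theorem eq_counit_of_conv_self {χ : H →ₐ[k] k} (h : Q.conv χ χ = χ) : χ = Q.counit := by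
  -- Convolve `χ * χ = χ` on the left with the left inverse of `χ`.
  have h1 := Q.conv_assoc (Q.charAntipode χ) χ χ
  rwa [h, conv_charAntipode, Q.counit_conv] at h1

/-- A central idempotent group-like element with counit `1` is the unit. -/
theorem eq_one_of_isYDPair_counit {v : H} (hv : Q.IsYDPair Q.counit v) (hvv : v * v = v) :
    v = 1 := by
  have hcomm : ∀ h, h * v = v * h := fun h => by
    simpa [Q.counit_fst, Q.counit_snd] using hv.comm h
  have hΔ : Q.comul v = v ⊗ₜ v := by
    have h := hv.comul
    rw [Q.normalized, Q.contr₁_counit_Φ, Q.contr₃_counit_Φ] at h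
    simpa using h.symm
  have h1 := Q.S_alpha v
  rw [hΔ, hv.counit] at h1
  simp only [TensorProduct.map_tmul, LinearMap.comp_apply, LinearMap.mulRight_apply,
    LinearMap.id_apply, LinearMap.mul'_apply, one_smul] at h1
  -- The identity `S(v) α v = α` and idempotence let `α` absorb `v`.
  have hα : Q.α * v = Q.α := by
    calc Q.α * v = Q.S v * Q.α * (v * v) := by rw [← mul_assoc, h1]
      _ = Q.α := by rw [hvv, h1]
  -- Centrality moves `v` through each term until it stands next to `α` and is absorbed; for `t = Φ`
  -- the expression is `1`, so `v = 1`.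
  have key : ∀ t : H ⊗[k] (H ⊗[k] H), v * (LinearMap.mul' k H
      (TensorProduct.map (LinearMap.mulRight k Q.β)
        (LinearMap.mul' k H ∘ₗ TensorProduct.map (LinearMap.mulRight k Q.α ∘ₗ Q.S) LinearMap.id)
        t)) = LinearMap.mul' k H
      (TensorProduct.map (LinearMap.mulRight k Q.β)
        (LinearMap.mul' k H ∘ₗ TensorProduct.map (LinearMap.mulRight k Q.α ∘ₗ Q.S) LinearMap.id)
        t) := by
    intro t
    induction t with
    | zero => simp
    | tmul x s =>
      induction s with
      | zero => simp
      | tmul y z =>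
        simp only [TensorProduct.map_tmul, LinearMap.comp_apply, LinearMap.mulRight_apply,
          LinearMap.id_apply, LinearMap.mul'_apply]
        rw [← mul_assoc, ← hcomm, mul_assoc, ← mul_assoc v, ← hcomm, mul_assoc (Q.S y * Q.α),
          ← mul_assoc _ v, mul_assoc _ Q.α v, hα]
      | add y z hy hz => rw [TensorProduct.tmul_add, map_add, map_add, mul_add, hy, hz]
    | add x y hx hy => rw [map_add, map_add, mul_add, hx, hy]
  have h2 := key (Q.Φ : H ⊗[k] (H ⊗[k] H))
  rwa [Q.Φ_antipode, mul_one] at h2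

end QuasiHopfAlgebra

/-! ### Classification -/

namespace BraidedHopfData

variable {k H B : Type*} [Field k] [Ring H] [Algebra k H] [AddCommGroup B] [Module k B]
  {D : BraidedHopfData k H B}

theorem exists_basis_of_finrank_eq_two {Q : QuasiBialgebra k H} (hD : D.IsYDBialgebra Q)
    (hB : Module.finrank k B = 2) :
    ∃ b : Module.Basis (Fin 2) k B, b 0 = D.one ∧ D.counit (b 1) = 0 := by
  have : FiniteDimensional k B := Module.finite_of_finrank_pos (by omega)
  obtain ⟨n, hn, hn0⟩ : ∃ n, D.counit n = 0 ∧ n ≠ 0 := by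
    by_contra! h
    have := LinearMap.finrank_le_finrank_of_injective
      ((injective_iff_map_eq_zero D.counit).2 h)
    rw [hB, Module.finrank_self] at this
    omega
  have hli : LinearIndependent k ![D.one, n] := by
    rw [LinearIndependent.pair_iff]
    intro x y hxy
    have hx : x = 0 := by simpa [hn, hD.counit_one] using congrArg D.counit hxy
    refine ⟨hx, ?_⟩
    simpa [hx, hn0] using hxy
  exact ⟨basisOfLinearIndependentOfCardEqFinrank hli (by simp [hB]), by simp, by simp [hn]⟩

theorem _root_.Module.Basis.eq_add_of_fin_two (b : Module.Basis (Fin 2) k B) (x : B) :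
    x = b.coord 0 x • b 0 + b.coord 1 x • b 1 :=
  (b.sum_repr x).symm.trans (Fin.sum_univ_two _)

/-- The counit is `H`-linear, so its kernel, the line through `b 1`, is stable under `H`. -/
theorem exists_act_eq {Q : QuasiBialgebra k H} (hD : D.IsYDCoalgebra Q)
    (b : Module.Basis (Fin 2) k B) (h0 : D.counit (b 0) = 1) (h1 : D.counit (b 1) = 0) :
    ∃ σ : H →ₐ[k] k, ∀ h, D.act h (b 1) = σ h • b 1 := by
  have key : ∀ h, D.act h (b 1) = b.coord 1 (D.act h (b 1)) • b 1 := fun h => by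
    have hc : b.coord 0 (D.act h (b 1)) = 0 := by
      have h2 := hD.act_counit h (b 1)
      rw [b.eq_add_of_fin_two (D.act h (b 1))] at h2
      simpa [h0, h1] using h2
    conv_lhs => rw [b.eq_add_of_fin_two (D.act h (b 1)), hc, zero_smul, zero_add]
  refine ⟨AlgHom.ofLinearMap
    (b.coord 1 ∘ₗ LinearMap.applyₗ (b 1) ∘ₗ D.act.toLinearMap) (by simp) (fun x y => ?_), key⟩
  simp only [LinearMap.comp_apply, AlgHom.toLinearMap_apply, LinearMap.applyₗ_apply_apply, map_mul,
    Module.End.mul_apply]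
  rw [key y, map_smul, map_smul, smul_eq_mul, mul_comm]
  simp

/-- Colinearity of the counit kills the component of the coaction along `b 0`. -/
theorem exists_coact_eq {Q : QuasiBialgebra k H} (hD : D.IsYDCoalgebra Q)
    (b : Module.Basis (Fin 2) k B) (h0 : D.counit (b 0) = 1) (h1 : D.counit (b 1) = 0) :
    ∃ v : H, D.coact (b 1) = v ⊗ₜ b 1 := by
  have hx : ∀ t : H ⊗[k] B, ∃ u v : H, t = u ⊗ₜ b 0 + v ⊗ₜ b 1 := by
    intro t
    induction t with
    | zero => exact ⟨0, 0, by simp⟩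
    | tmul x y =>
      refine ⟨b.coord 0 y • x, b.coord 1 y • x, ?_⟩
      conv_lhs => rw [b.eq_add_of_fin_two y]
      simp only [TensorProduct.tmul_add, TensorProduct.smul_tmul]
    | add x y hx hy =>
      obtain ⟨u, v, rfl⟩ := hx
      obtain ⟨u', v', rfl⟩ := hy
      exact ⟨u + u', v + v', by simp only [TensorProduct.add_tmul]; abel⟩
  obtain ⟨u, v, huv⟩ := hx (D.coact (b 1))
  have h2 := hD.coact_counit (b 1)
  rw [huv] at h2
  simp [h0, h1] at h2
  exact ⟨v, by simpa [h2] using huv⟩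

theorem exists_comul_eq {Q : QuasiBialgebra k H} (hD : D.IsYDCoalgebra Q)
    (b : Module.Basis (Fin 2) k B) (h0 : D.counit (b 0) = 1) (h1 : D.counit (b 1) = 0) :
    ∃ μ : k, D.comul (b 1) = b 1 ⊗ₜ b 0 + b 0 ⊗ₜ b 1 + μ • (b 1 ⊗ₜ b 1) := by
  obtain ⟨w, x, y, z, hw⟩ : ∃ w x y z : k, D.comul (b 1) =
      w • (b 0 ⊗ₜ b 0) + x • (b 0 ⊗ₜ b 1) + y • (b 1 ⊗ₜ b 0) + z • (b 1 ⊗ₜ b 1) := by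
    have := (b.tensorProduct b).sum_repr (D.comul (b 1))
    simp only [Fintype.sum_prod_type, Fin.sum_univ_two, Module.Basis.tensorProduct_apply] at this
    exact ⟨_, _, _, _, by rw [add_assoc (_ + _)]; exact this.symm⟩
  have h2 := hD.counit_fst (b 1)
  have h3 := hD.counit_snd (b 1)
  rw [hw] at h2 h3
  simp [h0, h1] at h2 h3
  have hw0 : w = 0 := by simpa using congrArg (b.coord 0) h2
  have hx1 : x = 1 := by simpa using congrArg (b.coord 1) h2
  have hy1 : y = 1 := by simpa using congrArg (b.coord 1) h3
  exact ⟨z, by rw [hw, hw0, hx1, hy1]; module⟩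

theorem exists_mul_eq {Q : QuasiBialgebra k H} (hD : D.IsYDBialgebra Q)
    (b : Module.Basis (Fin 2) k B) (h0 : D.counit (b 0) = 1) (h1 : D.counit (b 1) = 0) :
    ∃ c : k, D.mul (b 1 ⊗ₜ b 1) = c • b 1 := by
  refine ⟨b.coord 1 (D.mul (b 1 ⊗ₜ b 1)), ?_⟩
  have h2 := hD.counit_mul (b 1) (b 1)
  rw [b.eq_add_of_fin_two (D.mul _)] at h2
  have h3 : b.coord 0 (D.mul (b 1 ⊗ₜ b 1)) = 0 := by simpa [h0, h1] using h2
  conv_lhs => rw [b.eq_add_of_fin_two (D.mul _), h3, zero_smul, zero_add]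

theorem IsYDHopfAlgebra.exists_hasTwoDimShape {Q : QuasiBialgebra k H} (hD : D.IsYDHopfAlgebra Q)
    (hB : Module.finrank k B = 2) :
    ∃ b σ v c μ s, D.HasTwoDimShape Q b σ v c μ s ∧ 1 + s + μ * s * c = 0 := by
  obtain ⟨b, hb, h1⟩ := exists_basis_of_finrank_eq_two hD.toIsYDBialgebra hB
  have h0 : D.counit (b 0) = 1 := by rw [hb, hD.counit_one]
  obtain ⟨σ, hσ⟩ := exists_act_eq hD.toIsYDCoalgebra b h0 h1
  obtain ⟨v, hv⟩ := exists_coact_eq hD.toIsYDCoalgebra b h0 h1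
  obtain ⟨μ, hμ⟩ := exists_comul_eq hD.toIsYDCoalgebra b h0 h1
  obtain ⟨c, hc⟩ := exists_mul_eq hD.toIsYDBialgebra b h0 h1
  have hΔ : D.comul (b 0) = b 0 ⊗ₜ b 0 := by rw [hb, hD.comul_one]
  have l (x) : D.mul (b 0 ⊗ₜ x) = x := by rw [hb, hD.one_mul]
  have r (x) : D.mul (x ⊗ₜ b 0) = x := by rw [hb, hD.mul_one]
  have hS0 : D.antipode (b 0) = b 0 := by
    simpa [hΔ, r, h0, ← hb] using hD.antipode_fst (b 0)
  have hS1 := hD.antipode_fst (b 1)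
  set s := b.coord 1 (D.antipode (b 1))
  set a := b.coord 0 (D.antipode (b 1))
  have hs : D.antipode (b 1) = a • b 0 + s • b 1 := b.eq_add_of_fin_two _
  rw [hμ, h1, zero_smul] at hS1
  simp only [map_add, map_smul, TensorProduct.map_tmul, LinearMap.id_apply, hS0, l, r, hs,
    TensorProduct.add_tmul, ← TensorProduct.smul_tmul', hc] at hS1
  -- With `S(n) = a 1 + s n`, the axiom reads `S(n) + n + μ S(n) n = 0`. Its coefficient at `1` is
  -- `a`; its coefficient at `n` then gives `1 + s + μsc = 0`.
  have ha : a = 0 := by simpa using congrArg (b.coord 0) hS1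
  have hs' := congrArg (b.coord 1) hS1
  refine ⟨b, σ, v, c, μ, s, ⟨hb.symm, ⟨fun h => ?_, ?_⟩, ⟨hσ, hv⟩, l _, l _, r _, hc, hΔ, hμ, h0, h1,
    hS0, ?_⟩, ?_⟩
  · rw [hb, hD.act_one]
  · rw [hb, hD.coact_one]
  · rw [hs, ha, zero_smul, zero_add]
  · simp [ha] at hs'
    linear_combination hs'

namespace HasTwoDimShape

variable {Q : QuasiBialgebra k H} {b : Module.Basis (Fin 2) k B} {σ : H →ₐ[k] k} {v : H}
  {c μ s : k}

theorem conv_self_of_mul (hS : D.HasTwoDimShape Q b σ v c μ s) (hD : D.IsYDAlgebra Q)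
    (hc : c ≠ 0) : Q.conv σ σ = σ := by
  ext h
  have h1 := hD.act_mul h (b 1 ⊗ₜ b 1)
  rw [actDiag_of_eigen Q hS.eigen_one.act hS.eigen_one.act, map_smul, hS.mul_one_one, map_smul,
    hS.eigen_one.act] at h1
  have h2 := congrArg (b.coord 1) h1
  simp [mul_comm c, hc] at h2
  exact h2.symm

theorem conv_self_of_comul (hS : D.HasTwoDimShape Q b σ v c μ s) (hD : D.IsYDCoalgebra Q)
    (hμ : μ ≠ 0) : Q.conv σ σ = σ := by
  ext h
  have h1 := hD.act_comul h (b 1)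
  have e0 := hS.eigen_zero.act
  have e1 := hS.eigen_one.act
  rw [e1, map_smul, hS.comul_one, map_add, map_add, map_smul, actDiag_of_eigen Q e1 e1,
    actDiag_of_eigen Q e0 e1, actDiag_of_eigen Q e1 e0] at h1
  have h2 := congrArg ((b.tensorProduct b).coord (1, 1)) h1
  simp [hμ, mul_comm _ μ] at h2
  exact h2.symm

/-- Since `n² = 0`, the coefficient of `n ⊗ n` in `Δ(n)Δ(n)`, namely `1 + σ(v)`, must vanish; the
term `σ(v)` comes from braiding `n` past `n`. -/
theorem sigma_v_of_zero (hS : D.HasTwoDimShape Q b σ v 0 0 s) (hD : D.IsYDBialgebra Q) :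
    σ v = -1 := by
  have e0 := hS.eigen_zero.act
  have e1 := hS.eigen_one.act
  have u0 := hS.eigen_zero.coact
  have u1 := hS.eigen_one.coact
  have h1 := hD.comul_mul (b 1) (b 1)
  simp [hS.mul_zero_zero, hS.mul_zero_one, hS.mul_one_zero, hS.mul_one_one,
    hS.comul_one, TensorProduct.add_tmul, TensorProduct.tmul_add, mulTensorScalar,
    mulTensor_of_eigen Q D.mul e0 e1 e0 e1 u1, mulTensor_of_eigen Q D.mul e0 e1 e1 e0 u1,
    mulTensor_of_eigen Q D.mul e1 e0 e0 e1 u0, mulTensor_of_eigen Q D.mul e1 e0 e1 e0 u0] at h1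
  have h2 := congrArg ((b.tensorProduct b).coord (1, 1)) h1
  simp at h2
  linear_combination -h2

/-- For `σ = ε` all scalars are `1`, since `ε(v) = 1`. Comparing coefficients of `n ⊗ n` in `Δ(n²) =
Δ(n)Δ(n)` gives `cμ = 2 + 4cμ + (cμ)²`. -/
theorem mul_eq_of_counit (hS : D.HasTwoDimShape Q b Q.counit v c μ s) (hD : D.IsYDBialgebra Q)
    (hv : Q.IsYDPair Q.counit v) : (1 + c * μ) * (2 + c * μ) = 0 := by
  have e0 := hS.eigen_zero.act
  have e1 := hS.eigen_one.act
  have u0 := hS.eigen_zero.coact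
  have u1 := hS.eigen_one.coact
  have h1 := hD.comul_mul (b 1) (b 1)
  simp [hS.mul_zero_zero, hS.mul_zero_one, hS.mul_one_zero, hS.mul_one_one, hv.counit,
    hS.comul_one, TensorProduct.add_tmul, TensorProduct.tmul_add, mulTensorScalar,
    ← TensorProduct.smul_tmul',
    mulTensor_of_eigen Q D.mul e0 e1 e0 e1 u1, mulTensor_of_eigen Q D.mul e0 e1 e1 e0 u1,
    mulTensor_of_eigen Q D.mul e1 e0 e0 e1 u0, mulTensor_of_eigen Q D.mul e1 e0 e1 e0 u0,
    mulTensor_of_eigen Q D.mul e1 e1 e0 e1 u1, mulTensor_of_eigen Q D.mul e1 e1 e1 e0 u1,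
    mulTensor_of_eigen Q D.mul e0 e1 e1 e1 u1, mulTensor_of_eigen Q D.mul e1 e0 e1 e1 u0,
    mulTensor_of_eigen Q D.mul e1 e1 e1 e1 u1] at h1
  have h2 := congrArg ((b.tensorProduct b).coord (1, 1)) h1
  simp at h2
  linear_combination -h2

/-- The coaction of `n ⊗ n` is `v² ⊗ (n ⊗ n)`, and that of `n² = c n` is `c v ⊗ n`. -/
theorem v_mul_v_of_counit (hS : D.HasTwoDimShape Q b Q.counit v c μ s) (hD : D.IsYDAlgebra Q)
    (hc : c ≠ 0) : v * v = v := by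
  have e1 := hS.eigen_one.act
  have u1 := hS.eigen_one.coact
  have h1 := hD.coact_mul (b 1 ⊗ₜ b 1)
  rw [coactTensor_of_eigen_left Q e1 e1 u1 u1, TensorProduct.map_tmul, hS.mul_one_one, map_smul, u1,
    TensorProduct.tmul_smul] at h1
  exact (tmul_right_cancel (b.ne_zero 1) (smul_right_injective _ hc h1)).symm

end HasTwoDimShape

theorem IsYDHopfAlgebra.classification {Q : QuasiHopfAlgebra k H} (h2 : (2 : k) ≠ 0)
    (hD : D.IsYDHopfAlgebra Q.toQuasiBialgebra) (hB : Module.finrank k B = 2) :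
    (∃ (σ : H →ₐ[k] k) (v : H), IsAdmissiblePair Q.toQuasiBialgebra σ v ∧
        D.Isomorphic (braidedB Q.toQuasiBialgebra σ v)) ∨
      D.Isomorphic (trivialC₂ Q.toQuasiBialgebra) := by
  obtain ⟨b, σ, v, c, μ, s, hS, hs⟩ := hD.exists_hasTwoDimShape hB
  have hv := hS.eigen_one.isYDPair (b.ne_zero 1) hD.toIsYDModule
  by_cases hσ : σ = Q.counit
  · right
    subst hσ
    have h3 := hS.mul_eq_of_counit hD.toIsYDBialgebra hv
    -- The antipode relation is `1 + s(1 + cμ) = 0`, so a vanishing `1 + cμ` would give `1 = 0`.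
    have h4 : 1 + c * μ ≠ 0 := fun h => one_ne_zero (α := k) (by linear_combination hs - s * h)
    have h5 : c * μ = -2 := by linear_combination (mul_eq_zero.1 h3).resolve_left h4
    have hc : c ≠ 0 := by
      rintro rfl
      exact h2 (by linear_combination h5)
    obtain rfl : μ = -2 / c := by rw [eq_div_iff hc, mul_comm, h5]
    obtain rfl : s = 1 := by linear_combination -hs + s * h5
    obtain rfl := Q.eq_one_of_isYDPair_counit hv (hS.v_mul_v_of_counit hD.toIsYDAlgebra hc)
    obtain ⟨b', hb'⟩ := exists_hasTwoDimShape_trivialC₂ Q.toQuasiBialgebra h2 hc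
    exact hS.isomorphic hb'
  · left
    have hc : c = 0 := by
      by_contra hc
      exact hσ (Q.eq_counit_of_conv_self (hS.conv_self_of_mul hD.toIsYDAlgebra hc))
    have hμ : μ = 0 := by
      by_contra hμ
      exact hσ (Q.eq_counit_of_conv_self (hS.conv_self_of_comul hD.toIsYDCoalgebra hμ))
    subst hc hμ
    obtain rfl : s = -1 := by linear_combination hs
    exact ⟨σ, v, (Q.isAdmissiblePair_iff σ v).2 ⟨hv, hS.sigma_v_of_zero hD.toIsYDBialgebra⟩,
      hS.isomorphic (hasTwoDimShape_braidedB _ σ v)⟩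

end BraidedHopfData

end

theorem mainTheorem1 {k : Type*} {H : Type*} [Field k] (hk : ringChar k ≠ 2)
    [Ring H] [Algebra k H] (Q : QuasiHopfAlgebra k H) (hS : Function.Bijective Q.S) :
    (∀ (σ : H →ₐ[k] k) (v : H), IsAdmissiblePair Q.toQuasiBialgebra σ v →
      (braidedB Q.toQuasiBialgebra σ v).IsYDHopfAlgebra Q.toQuasiBialgebra) ∧
    (trivialC₂ Q.toQuasiBialgebra).IsYDHopfAlgebra Q.toQuasiBialgebra ∧
    ∀ {B : Type*} [AddCommGroup B] [Module k B] (D : BraidedHopfData k H B),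
      D.IsYDHopfAlgebra Q.toQuasiBialgebra → Module.finrank k B = 2 →
        (∃ (σ : H →ₐ[k] k) (v : H), IsAdmissiblePair Q.toQuasiBialgebra σ v ∧
          D.Isomorphic (braidedB Q.toQuasiBialgebra σ v)) ∨
        D.Isomorphic (trivialC₂ Q.toQuasiBialgebra) := by
  have h2 : (2 : k) ≠ 0 := Ring.two_ne_zero hk
  refine ⟨fun σ v hv => ?_, BraidedHopfData.isYDHopfAlgebra_trivialC₂ _,
    fun D hD hB => hD.classification h2 hB⟩
  obtain ⟨hv, hσ⟩ := (Q.isAdmissiblePair_iff σ v).1 hv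
  exact (BraidedHopfData.hasTwoDimShape_braidedB _ σ v).isYDHopfAlgebra hv hσ
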